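/- Let $\mathcal A$ be the ring of formal power series in $\varepsilon$ whose coefficients are differential polynomials in $(u^1,u^2,u^3)=(u,v,w)$, i.e. polynomials in the jet variables $u^{\alpha,s}=\partial_x^su^\alpha$ ($s\ge1$) with coefficients smooth in $(u,v,w)$ on the domain $w/v>0$. Let $\partial_x=\sum_{\alpha,s}u^{\alpha,s+1}\partial/\partial u^{\alpha,s}$, $\Lambda=e^{\varepsilon\partial_x}$, and let $\int\cdot\,\mathrm dx$ be the projection $\mathcal A\to\mathcal A/\partial_x\mathcal A$, with $\frac{\delta}{\delta u^\alpha}\int h\,\mathrm dx=\sum_{s\ge0}(-\partial_x)^s\frac{\partial h}{\partial u^{\alpha,s}}$. For a difference operator $X=\sum_s a_s\Lambda^s$ put $X_+=\sum_{s\ge0}a_s\Lambda^s$, $X_-=\sum_{s\le-1}a_s\Lambda^s$, $\operatorname{Res}X=a_0$. Let $$A=\Lambda^2+u\Lambda+v,\quad B=1-w\Lambda^{-1},\quad L=B^{-1}A,\quad \tilde L=AB^{-1},\quad M=A^{-1}B,\quad \tilde M=BA^{-1},$$ where $B^{-1}$ is expanded in nonpositive and $A^{-1}$ in nonnegative powers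 of $\Lambda$, and let $L^{1/2},\tilde L^{1/2}$ be the square roots of $L,\tilde L$ of the form $\Lambda+\sum_{r\ge0}c_r\Lambda^{-r}$. The rational reduction of the 2D-Toda hierarchy of type $(2,1)$ consists of the evolutionary flows given, for $k\ge0$ and for both $Z=A$ and $Z=B$, by $$\varepsilon\frac{\partial Z}{\partial t^{2,k}}=\frac{2^{k+1/2}}{(2k+1)!!}\Big((\tilde L^{k+\frac12})_+Z-Z(L^{k+\frac12})_+\Big),\qquad \varepsilon\frac{\partial Z}{\partial t^{3,k}}=\frac{1}{(k+1)!}\Big((\tilde L^{k+1})_+Z-Z(L^{k+1})_+\Big),$$ $$\varepsilon\frac{\partial Z}{\partial t^{0,-k-1}}=(-1)^kk!\Big((\tilde M^{k+1})_-Z-Z(M^{k+1})_-\Big).$$ **Theorem.** The matrix difference operator $$\mathcal P_1=\begin{pmatrix}\Lambda-\Lambda^{-1}&w\Lambda^{-1}-\Lambda^2w&0\\ w\Lambda^{-2}-\Lambda w&w\Lambda^{-1}u-u\Lambda w&(\Lambda-1)w\\0&w(1-\Lambda^{-1})&0\end{pmatrix}$$ is Hamiltonian, i.e. it is skew-adjoint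 and the bracket $\{F,G\}=\int\sum_{\alpha,\beta}\frac{\delta F}{\delta u^\alpha}\mathcal P_1^{\alpha\beta}\frac{\delta G}{\delta u^\beta}\,\mathrm dx$ of local functionals satisfies the Jacobi identity. For $i\in\{2,3\}$, $k\ge0$, and for $i=0$, $k\le-1$, the equations above for $A$ and $B$ determine a unique flow $\partial/\partial t^{i,k}$, and they are equivalent to the Hamiltonian system $$\varepsilon\frac{\partial}{\partial t^{i,k}}\begin{pmatrix}u\\v\\w\end{pmatrix}=\mathcal P_1\begin{pmatrix}\delta H_{i,k}/\delta u\\ \delta H_{i,k}/\delta v\\ \delta H_{i,k}/\delta w\end{pmatrix},$$ with the Hamiltonians $$H_{2,k}=\frac{2^{k+\frac32}}{(2k+3)!!}\int\operatorname{Res}\big(L^{k+\frac32}\big)\mathrm dx,\qquad H_{3,k}=\frac1{(k+2)!}\int\operatorname{Res}\big(L^{k+2}\big)\mathrm dx\qquad(k\ge0),$$ $$H_{0,-k-1}=(-1)^k(k-1)!\int\operatorname{Res}\big(M^k\big)\mathrm dx\quad(k\ge1),\qquad H_{0,-1}=\int\log\frac wv\,\mathrm dx.$$ -/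

import Mathlib

open scoped ContDiff

namespace RR2T

noncomputable section

/-! ### Smooth functions of `(u, v, w)` on the domain where `w / v > 0` -/

/-- The domain of the dependent variables `(u, v, w) = (p 0, p 1, p 2)`: `v` and `w` are nonzero and
of the same sign, so that `1 / v` and `log (w / v)` are smooth functions on it. -/
def dom : Set (Fin 3 → ℝ) := {p | 0 < p 1 * p 2}

theorem isOpen_dom : IsOpen dom :=
  isOpen_lt continuous_const ((continuous_apply 1).mul (continuous_apply 2))

open Classical in
/-- Extension by zero of a function on the domain. -/
def ext0 (f : dom → ℝ) (p : Fin 3 → ℝ) : ℝ := if h : p ∈ dom then f ⟨p, h⟩ else 0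

theorem ext0_apply (f : dom → ℝ) {p : Fin 3 → ℝ} (h : p ∈ dom) : ext0 f p = f ⟨p, h⟩ := by
  simp [ext0, h]

/-- The algebra `C^∞(dom)`. -/
def smoothSubalgebra : Subalgebra ℝ (dom → ℝ) where
  carrier := {f | ContDiffOn ℝ ∞ (ext0 f) dom}
  mul_mem' {f g} hf hg := (ContDiffOn.mul hf hg).congr fun p hp => by simp [ext0_apply _ hp]
  add_mem' {f g} hf hg := (ContDiffOn.add hf hg).congr fun p hp => by simp [ext0_apply _ hp]
  algebraMap_mem' r := (contDiffOn_const (c := r)).congr fun p hp => by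
    simp [ext0_apply _ hp]

/-- The ring `C^∞(dom)` as a type. -/
def SmoothFun : Type := smoothSubalgebra

instance : CommRing SmoothFun := inferInstanceAs (CommRing smoothSubalgebra)

instance : Algebra ℝ SmoothFun := inferInstanceAs (Algebra ℝ smoothSubalgebra)

/-- A function that is smooth on the domain, as an element of `C^∞(dom)`. -/
def mkSmooth (f : (Fin 3 → ℝ) → ℝ) (hf : ContDiffOn ℝ ∞ f dom) : SmoothFun :=
  ⟨fun p => f p, hf.congr fun p hp => by simp [ext0_apply _ hp]⟩

/-- The coordinate functions `u, v, w` for `α = 0, 1, 2`. -/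
def coordFun (α : Fin 3) : SmoothFun :=
  mkSmooth (fun p => p α) (contDiff_apply ℝ ℝ α).contDiffOn

theorem ne_zero_of_mem {p : Fin 3 → ℝ} (hp : p ∈ dom) : p 1 ≠ 0 ∧ p 2 ≠ 0 := by
  have h : (0 : ℝ) < p 1 * p 2 := hp
  exact ⟨left_ne_zero_of_mul h.ne', right_ne_zero_of_mul h.ne'⟩

/-- The function `1 / v`. -/
def invVFun : SmoothFun :=
  mkSmooth (fun p => (p 1)⁻¹)
    ((contDiff_apply ℝ ℝ 1).contDiffOn.inv fun _ hp => (ne_zero_of_mem hp).1)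

/-- The function `log (w / v)`. -/
def logWVFun : SmoothFun :=
  mkSmooth (fun p => Real.log (p 2 / p 1))
    (((contDiff_apply ℝ ℝ 2).contDiffOn.div (contDiff_apply ℝ ℝ 1).contDiffOn
      fun _ hp => (ne_zero_of_mem hp).1).log
      fun _ hp => div_ne_zero (ne_zero_of_mem hp).2 (ne_zero_of_mem hp).1)

theorem differentiableAt_ext0 (f : SmoothFun) (p : dom) :
    DifferentiableAt ℝ (ext0 f.1) p.1 :=
  ((f.2 : ContDiffOn ℝ ∞ (ext0 f.1) dom).contDiffAt
    (isOpen_dom.mem_nhds p.2)).differentiableAt (by simp)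

/-- The partial derivative `∂ / ∂u^α` on `C^∞(dom)`. -/
def partialFun (α : Fin 3) : SmoothFun →ₗ[ℝ] SmoothFun where
  toFun f := ⟨fun p => fderiv ℝ (ext0 f.1) p.1 (Pi.single α 1), by
    have h : ContDiffOn ℝ ∞ (fderiv ℝ (ext0 f.1)) dom :=
      ContDiffOn.fderiv_of_isOpen f.2 isOpen_dom (by simp)
    exact (h.clm_apply (contDiffOn_const (c := (Pi.single α 1 : Fin 3 → ℝ)))).congr
      fun p hp => by simp [ext0_apply _ hp]⟩
  map_add' f g := by
    refine Subtype.ext (funext fun p => ?_)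
    have h : ext0 (f.1 + g.1) = ext0 f.1 + ext0 g.1 := by
      funext q; by_cases hq : q ∈ dom <;> simp [ext0, hq]
    change fderiv ℝ (ext0 (f.1 + g.1)) p.1 _ = _
    rw [h, fderiv_add (differentiableAt_ext0 f p) (differentiableAt_ext0 g p)]
    rfl
  map_smul' c f := by
    refine Subtype.ext (funext fun p => ?_)
    have h : ext0 (c • f.1) = c • ext0 f.1 := by
      funext q; by_cases hq : q ∈ dom <;> simp [ext0, hq]
    change fderiv ℝ (ext0 (c • f.1)) p.1 _ = _
    rw [h, fderiv_const_smul (differentiableAt_ext0 f p)]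
    rfl

/-! ### Differential polynomials -/

/-- Differential polynomials: polynomials in the jet variables `u^{α,s+1}`, represented by the
indeterminate `(α, s)`, with coefficients in `C^∞(dom)`. -/
abbrev DiffPoly : Type := MvPolynomial (Fin 3 × ℕ) SmoothFun

/-- The jet variable `u^{α,s} = ∂_x^s u^α`. -/
def jet (α : Fin 3) : ℕ → DiffPoly
  | 0 => MvPolynomial.C (coordFun α)
  | s + 1 => MvPolynomial.X (α, s)

/-- An `ℝ`-linear map of `C^∞(dom)`, applied to the coefficients of differential polynomials. -/
def mapCoeffs (D : SmoothFun →ₗ[ℝ] SmoothFun) : DiffPoly →ₗ[ℝ] DiffPoly :=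
  have key : ∀ (p : DiffPoly) (n : Fin 3 × ℕ →₀ ℕ),
      (∑ m ∈ p.support, MvPolynomial.monomial m (D (p.coeff m))).coeff n = D (p.coeff n) := by
    intro p n
    classical
    simp only [MvPolynomial.coeff_sum, MvPolynomial.coeff_monomial]
    rw [Finset.sum_ite_eq' p.support n]
    split_ifs with h
    · rfl
    · rw [MvPolynomial.notMem_support_iff.mp h, map_zero]
  { toFun p := ∑ m ∈ p.support, MvPolynomial.monomial m (D (p.coeff m))
    map_add' p q := by
      ext1 n
      rw [MvPolynomial.coeff_add, key, key, key, MvPolynomial.coeff_add, map_add]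
    map_smul' c p := by
      ext1 n
      rw [RingHom.id_apply, MvPolynomial.coeff_smul, key, key, MvPolynomial.coeff_smul, map_smul] }

/-- The partial derivative `∂ / ∂u^{α,s}`. -/
def pd (α : Fin 3) : ℕ → DiffPoly →ₗ[ℝ] DiffPoly
  | 0 => mapCoeffs (partialFun α)
  | s + 1 => (MvPolynomial.pderiv (α, s)).toLinearMap.restrictScalars ℝ

/-- The total derivative `∂_x = ∑_{α,s} u^{α,s+1} ∂ / ∂u^{α,s}` on differential polynomials; the terms
with `s ≥ 1` are collected in the `C^∞(dom)`-linear derivation with `u^{α,s} ↦ u^{α,s+1}`. -/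
def dx : Module.End ℝ DiffPoly :=
  (∑ α, LinearMap.mulLeft ℝ (jet α 1) ∘ₗ pd α 0) +
    (MvPolynomial.mkDerivation SmoothFun
      fun i : Fin 3 × ℕ => jet i.1 (i.2 + 2)).toLinearMap.restrictScalars ℝ

/-! ### Formal power series in `ε` -/

/-- Formal power series in `ε` whose coefficients are differential polynomials. -/
abbrev Fld : Type := PowerSeries DiffPoly

/-- The formal parameter `ε`. -/
def eps : Fld := PowerSeries.X

/-- A differential function of order zero, as a constant series in `ε`. -/
def ofFun (f : SmoothFun) : Fld := PowerSeries.C (MvPolynomial.C f)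

/-- The dependent variable `u`. -/
def u : Fld := ofFun (coordFun 0)

/-- The dependent variable `v`. -/
def v : Fld := ofFun (coordFun 1)

/-- The dependent variable `w`. -/
def w : Fld := ofFun (coordFun 2)

/-- The total derivative `∂_x`, acting on each coefficient of a series in `ε`. -/
def dX : Module.End ℝ Fld where
  toFun f := PowerSeries.mk fun n => dx (PowerSeries.coeff n f)
  map_add' f g := by ext1 n; simp
  map_smul' c f := by ext1 n; simp

/-- The operator `φ(ε ∂_x) = ∑_k φ_k ε^k ∂_x^k` for a formal power series `φ` in one variable. -/
def symb (φ : PowerSeries ℝ) : Module.End ℝ Fld where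
  toFun f := PowerSeries.mk fun n =>
    ∑ ij ∈ Finset.HasAntidiagonal.antidiagonal n, PowerSeries.coeff ij.1 φ • (dx ^ ij.1) (PowerSeries.coeff ij.2 f)
  map_add' f g := by
    ext1 n
    simp [Finset.sum_add_distrib]
  map_smul' c f := by
    ext1 n
    simp only [PowerSeries.coeff_mk, RingHom.id_apply, PowerSeries.coeff_smul, map_smul,
      Finset.smul_sum]
    exact Finset.sum_congr rfl fun _ _ => smul_comm _ _ _

/-- The power `Λ^n = exp (n ε ∂_x)` of the shift operator. -/
def shift (n : ℤ) : Module.End ℝ Fld :=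
  symb (PowerSeries.rescale (n : ℝ) (PowerSeries.exp ℝ))

/-- The operator `(Λ + 1)⁻¹ = (exp (ε ∂_x) + 1)⁻¹`. -/
def shiftAddOneInv : Module.End ℝ Fld := symb (PowerSeries.exp ℝ + 1)⁻¹

/-- The variational derivative `∑_s (-∂_x)^s (∂f / ∂u^{α,s})` of the local functional `∫ f dx`. -/
def varDeriv (f : Fld) (α : Fin 3) : Fld :=
  PowerSeries.mk fun n => ∑ᶠ s : ℕ, ((-dx) ^ s) (pd α s (PowerSeries.coeff n f))

/-- The evolutionary vector field `∂_t` with `∂_t u^α = X α`, that is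
`∂_t f = ∑_{α,s} (∂_x^s (X α)) (∂f / ∂u^{α,s})`. -/
def evol (X : Fin 3 → Fld) (f : Fld) : Fld :=
  PowerSeries.mk fun n => ∑ ij ∈ Finset.HasAntidiagonal.antidiagonal n, ∑ α : Fin 3, ∑ᶠ s : ℕ,
    PowerSeries.coeff ij.1 ((dX ^ s) (X α)) * pd α s (PowerSeries.coeff ij.2 f)

/-! ### Difference operators -/

/-- A formal difference operator `∑_{n ∈ ℤ} a_n Λ^n`, given by its coefficients. -/
def Op : Type := ℤ → Fld

namespace Op

instance : AddCommGroup Op := inferInstanceAs (AddCommGroup (ℤ → Fld))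

instance : Module ℝ Op := inferInstanceAs (Module ℝ (ℤ → Fld))

/-- Left multiplication of all coefficients by a function. -/
instance : Module Fld Op := inferInstanceAs (Module Fld (ℤ → Fld))

/-- The operator `a Λ^n`. -/
def mono (a : Fld) (n : ℤ) : Op := fun m => if m = n then a else 0

instance : One Op := ⟨mono 1 0⟩

/-- The product determined by `(a Λ^i) (b Λ^j) = a (Λ^i b) Λ^{i+j}`. The sum is finite if the orders
of both factors are bounded above, if both are bounded below, or if one factor is a finite sum. -/
instance : Mul Op := ⟨fun X Y n => ∑ᶠ i : ℤ, X i * shift i (Y (n - i))⟩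

instance : Pow Op ℕ := ⟨fun X n => npowRec n X⟩

/-- The part `X_+` of nonnegative order. -/
def pos (X : Op) : Op := fun n => if 0 ≤ n then X n else 0

/-- The part `X_-` of negative order. -/
def neg (X : Op) : Op := fun n => if n ≤ -1 then X n else 0

/-- The residue, the coefficient of `Λ^0`. -/
def res (X : Op) : Fld := X 0

/-- The derivative of an operator along the evolutionary vector field with characteristic `X`. -/
def evol (X : Fin 3 → Fld) (Y : Op) : Op := fun n => RR2T.evol X (Y n)

/-- The coefficients `c_r` of the square root `Λ + ∑_{r ≥ 0} c_r Λ^{-r}` of `X = Λ² + ⋯`, from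
`(Λ + 1) c_r + ∑_{i + j + 1 = r} c_i Λ^{-i}(c_j) = X_{1-r}`. -/
def sqrtCoeff (X : Op) : ℕ → Fld
  | r => shiftAddOneInv (X (1 - r) -
      ∑ i : Fin r, sqrtCoeff X i * shift (-(i : ℤ)) (sqrtCoeff X (r - 1 - i)))

/-- The square root `Λ + ∑_{r ≥ 0} c_r Λ^{-r}` of an operator `X = Λ² + ⋯` of order two. -/
def sqrt (X : Op) : Op := fun n =>
  if n ≤ 0 then sqrtCoeff X (-n).toNat else if n = 1 then 1 else 0

end Op

/-- `A = Λ² + u Λ + v`. -/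
def opA : Op := Op.mono 1 2 + Op.mono u 1 + Op.mono v 0

/-- `B = 1 - w Λ⁻¹`. -/
def opB : Op := Op.mono 1 0 - Op.mono w (-1)

/-- The coefficient of `Λ^{-n}` in `B⁻¹`, from `B B⁻¹ = 1`. -/
def opBInvCoeff : ℕ → Fld
  | 0 => 1
  | n + 1 => w * shift (-1) (opBInvCoeff n)

/-- `B⁻¹`, expanded in nonpositive powers of `Λ`. -/
def opBInv : Op := fun n => if n ≤ 0 then opBInvCoeff (-n).toNat else 0

/-- The coefficient of `Λ^n` in `A⁻¹`, from `A A⁻¹ = 1`. -/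
def opAInvCoeff : ℕ → Fld
  | 0 => ofFun invVFun
  | 1 => -(ofFun invVFun * (u * shift 1 (opAInvCoeff 0)))
  | n + 2 => -(ofFun invVFun * (u * shift 1 (opAInvCoeff (n + 1)) + shift 2 (opAInvCoeff n)))

/-- `A⁻¹`, expanded in nonnegative powers of `Λ`. -/
def opAInv : Op := fun n => if 0 ≤ n then opAInvCoeff n.toNat else 0

/-- `L = B⁻¹ A`. -/
def opL : Op := opBInv * opA

/-- `L̃ = A B⁻¹`. -/
def opLt : Op := opA * opBInv

/-- `M = A⁻¹ B`. -/
def opM : Op := opAInv * opB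

/-- `M̃ = B A⁻¹`. -/
def opMt : Op := opB * opAInv

/-! ### Characterization of the inverses and of the square root -/

theorem symb_mul (φ ψ : PowerSeries ℝ) : symb (φ * ψ) = symb φ * symb ψ := by
  refine LinearMap.ext fun f => ?_
  ext1 n
  simp only [symb, LinearMap.coe_mk, AddHom.coe_mk, PowerSeries.coeff_mk, Module.End.mul_apply,
    PowerSeries.coeff_mul, map_sum, map_smul, Finset.sum_smul, Finset.smul_sum]
  rw [Finset.sum_sigma', Finset.sum_sigma']
  refine Finset.sum_nbij' (fun a => ⟨(a.2.1, a.2.2 + a.1.2), (a.2.2, a.1.2)⟩)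
    (fun a => ⟨(a.1.1 + a.2.1, a.2.2), (a.1.1, a.2.1)⟩) ?_ ?_ ?_ ?_ ?_
  all_goals
    rintro ⟨⟨a, b⟩, ⟨c, d⟩⟩ h
    simp only [Finset.mem_sigma, Finset.HasAntidiagonal.mem_antidiagonal] at h ⊢
    obtain ⟨h1, h2⟩ := h
    subst h2
  · exact ⟨by omega, trivial⟩
  · exact ⟨by omega, trivial⟩
  · rfl
  · rfl
  · rw [smul_smul, pow_add, Module.End.mul_apply]

theorem symb_one : symb 1 = 1 := by
  refine LinearMap.ext fun f => ?_
  ext1 n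
  simp only [symb, LinearMap.coe_mk, AddHom.coe_mk, PowerSeries.coeff_mk, Module.End.one_apply]
  rw [Finset.sum_eq_single (0, n)]
  · simp
  · rintro ⟨a, b⟩ h h'
    have : a ≠ 0 := by
      rintro rfl
      simp_all
    simp [PowerSeries.coeff_one, this]
  · simp

theorem symb_add (φ ψ : PowerSeries ℝ) : symb (φ + ψ) = symb φ + symb ψ := by
  refine LinearMap.ext fun f => ?_
  ext1 n
  simp [symb, add_smul, Finset.sum_add_distrib]

theorem partialFun_one (α : Fin 3) : partialFun α 1 = 0 := by
  refine Subtype.ext (funext fun p => ?_)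
  have h : ext0 (fun _ => 1) =ᶠ[nhds p.1] fun _ => (1 : ℝ) := by
    filter_upwards [isOpen_dom.mem_nhds p.2] with q hq
    rw [ext0_apply _ hq]
  change fderiv ℝ (ext0 (fun _ => 1)) p.1 _ = (0 : ℝ)
  rw [h.fderiv_eq]
  simp

theorem dx_one : dx 1 = 0 := by
  have h : ∀ α, pd α 0 1 = 0 := fun α => by
    simp only [pd, mapCoeffs, LinearMap.coe_mk, AddHom.coe_mk]
    refine Finset.sum_eq_zero fun m _ => ?_
    classical
    rw [MvPolynomial.coeff_one]
    split_ifs <;> simp [partialFun_one]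
  have h' : ∀ D : Derivation SmoothFun DiffPoly DiffPoly,
      (D.toLinearMap.restrictScalars ℝ) 1 = 0 := fun D => D.map_one_eq_zero
  simp only [dx, LinearMap.add_apply, LinearMap.sum_apply, LinearMap.comp_apply, h, h']
  simp

theorem shift_zero : shift 0 = 1 := by
  rw [shift, Int.cast_zero, PowerSeries.rescale_zero_apply, ← symb_one]
  simp

theorem shift_one (n : ℤ) : shift n 1 = 1 := by
  ext1 m
  simp only [shift, symb, LinearMap.coe_mk, AddHom.coe_mk, PowerSeries.coeff_mk]
  rw [Finset.sum_eq_single (0, m)]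
  · simp
  · rintro ⟨a, b⟩ h h'
    obtain ⟨a, rfl⟩ := Nat.exists_eq_succ_of_ne_zero (n := a) (by rintro rfl; simp_all)
    rw [PowerSeries.coeff_one]
    split_ifs
    · rw [pow_succ, Module.End.mul_apply, dx_one]; simp
    · simp
  · simp

theorem shift_add_one_mul_inv : (shift 1 + 1) * shiftAddOneInv = 1 := by
  have h : PowerSeries.constantCoeff (PowerSeries.exp ℝ + 1) ≠ 0 := by
    simp only [map_add, PowerSeries.constantCoeff_exp, map_one]; norm_num
  rw [shift, Int.cast_one, PowerSeries.rescale_one, RingHom.id_apply, ← symb_one, ← symb_add,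
    shiftAddOneInv, ← symb_mul, PowerSeries.mul_inv_cancel _ h]

theorem v_mul_inv : v * ofFun invVFun = 1 := by
  have h : coordFun 1 * invVFun = 1 :=
    Subtype.ext (funext fun p => mul_inv_cancel₀ (ne_zero_of_mem p.2).1)
  rw [v, ofFun, ofFun, ← map_mul, ← map_mul, h, map_one, map_one]

namespace Op

theorem mul_apply (X Y : Op) (n : ℤ) :
    (X * Y) n = ∑ᶠ i : ℤ, X i * shift i (Y (n - i)) := rfl

theorem mul_apply_sum (X Y : Op) (n : ℤ) (s : Finset ℤ)
    (h : ∀ i ∉ s, X i = 0 ∨ Y (n - i) = 0) :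
    (X * Y) n = ∑ i ∈ s, X i * shift i (Y (n - i)) := by
  rw [mul_apply]
  refine finsum_eq_sum_of_support_subset _ fun i hi => ?_
  by_contra hs
  rcases h i hs with h | h <;> simp [h] at hi

end Op

theorem opA_mul_opAInv : opA * opAInv = 1 := by
  funext n
  have hA : ∀ i : ℤ, opA i =
      (if i = 2 then 1 else 0) + (if i = 1 then u else 0) + (if i = 0 then v else 0) :=
    fun _ => rfl
  rw [Op.mul_apply_sum _ _ _ {0, 1, 2} fun i hi => Or.inl (by
    simp only [Finset.mem_insert, Finset.mem_singleton, not_or] at hi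
    simp [hA, hi])]
  have h1 : (1 : Op) n = if n = 0 then 1 else 0 := rfl
  rw [h1]
  simp only [hA]
  norm_num
  rw [shift_zero, Module.End.one_apply]
  rcases lt_trichotomy n 0 with hn | rfl | hn
  · simp [opAInv, hn.not_ge, hn.ne, show ¬ (1 ≤ n) by omega, show ¬ (2 ≤ n) by omega]
  · simp [opAInv, opAInvCoeff, v_mul_inv]
  · obtain ⟨m, rfl⟩ : ∃ m : ℕ, n = m + 1 := ⟨(n - 1).toNat, by omega⟩
    rcases m with _ | m
    · simp [opAInv, opAInvCoeff, ← mul_assoc, v_mul_inv]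
    · have e1 : ((m + 1 : ℕ) : ℤ) + 1 - 1 = ((m + 1 : ℕ) : ℤ) := by omega
      have e2 : ((m + 1 : ℕ) : ℤ) + 1 - 2 = (m : ℤ) := by omega
      have e3 : ((m + 1 : ℕ) : ℤ) + 1 = ((m + 2 : ℕ) : ℤ) := by omega
      rw [e1, e2, e3, if_neg (by omega)]
      simp only [opAInv, Int.toNat_natCast, Int.natCast_nonneg, if_true, opAInvCoeff]
      linear_combination
        -(u * shift 1 (opAInvCoeff (m + 1)) + shift 2 (opAInvCoeff m)) * v_mul_inv

theorem opB_mul_opBInv : opB * opBInv = 1 := by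
  funext n
  have hB : ∀ i : ℤ, opB i = (if i = 0 then 1 else 0) - (if i = -1 then w else 0) :=
    fun _ => rfl
  rw [Op.mul_apply_sum _ _ _ {0, -1} fun i hi => Or.inl (by
    simp only [Finset.mem_insert, Finset.mem_singleton, not_or] at hi
    simp [hB, hi])]
  have h1 : (1 : Op) n = if n = 0 then 1 else 0 := rfl
  rw [h1]
  simp only [hB]
  norm_num
  rw [shift_zero, Module.End.one_apply]
  rcases lt_trichotomy n 0 with hn | rfl | hn
  · obtain ⟨m, rfl⟩ : ∃ m : ℕ, n = -(m + 1) := ⟨(-n - 1).toNat, by omega⟩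
    have e1 : (-(-((m : ℤ) + 1))).toNat = m + 1 := by omega
    have e2 : (-(-((m : ℤ) + 1) + 1)).toNat = m := by omega
    simp only [opBInv, e1, e2, opBInvCoeff]
    rw [if_pos (by omega), if_pos (by omega), if_neg (by omega)]
    ring
  · simp [opBInv, opBInvCoeff]
  · simp [opBInv, hn.not_ge, hn.ne', show ¬ (n + 1 ≤ 0) by omega]

/-- The square root of an operator `X = Λ² + ⋯` squares to `X`. -/
theorem Op.sqrt_mul_sqrt (X : Op) (h2 : X 2 = 1) (h3 : ∀ n, 2 < n → X n = 0) :
    X.sqrt * X.sqrt = X := by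
  funext n
  have hs : ∀ n : ℤ, X.sqrt n =
      if n ≤ 0 then sqrtCoeff X (-n).toNat else if n = 1 then 1 else 0 := fun _ => rfl
  have hz : ∀ i : ℤ, 1 < i → X.sqrt i = 0 := fun i hi => by
    rw [hs, if_neg (by omega), if_neg (by omega)]
  rw [Op.mul_apply_sum _ _ _ (Finset.Icc (n - 1) 1) fun i hi => by
    rw [Finset.mem_Icc, not_and_or] at hi
    rcases hi with hi | hi
    · exact Or.inr (hz _ (by omega))
    · exact Or.inl (hz _ (by omega))]
  rcases lt_trichotomy n 2 with hn | rfl | hn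
  · obtain ⟨r, rfl⟩ : ∃ r : ℕ, n = 1 - r := ⟨(1 - n).toNat, by omega⟩
    have hI : Finset.Icc (1 - (r : ℤ) - 1) 1 =
        insert 1 (insert (-(r : ℤ)) ((Finset.univ : Finset (Fin r)).image
          fun i : Fin r => -(i : ℤ))) := by
      ext j
      simp only [Finset.mem_Icc, Finset.mem_insert, Finset.mem_image, Finset.mem_univ, true_and]
      constructor
      · rintro ⟨h, h'⟩
        by_cases hj : j = 1
        · exact Or.inl hj
        by_cases hj' : j = -(r : ℤ)
        · exact Or.inr (Or.inl hj')
        · exact Or.inr (Or.inr ⟨⟨(-j).toNat, by omega⟩, by simp; omega⟩)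
      · rintro (rfl | rfl | ⟨i, rfl⟩)
        · omega
        · omega
        · have := i.2
          omega
    rw [hI, Finset.sum_insert, Finset.sum_insert, Finset.sum_image]
    · have a1 : X.sqrt 1 = 1 := by simp [hs]
      have a2 : X.sqrt (-(r : ℤ)) = sqrtCoeff X r := by simp [hs]
      have a3 : (1 : ℤ) - r - 1 = -r := by ring
      have a4 : (1 : ℤ) - r - -r = 1 := by ring
      have a5 : ∑ i : Fin r, X.sqrt (-(i : ℤ)) * shift (-(i : ℤ)) (X.sqrt (1 - r - -(i : ℤ))) =
          ∑ i : Fin r, sqrtCoeff X i * shift (-(i : ℤ)) (sqrtCoeff X (r - 1 - i)) := by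
        refine Finset.sum_congr rfl fun i _ => ?_
        have hi := i.2
        have b1 : X.sqrt (-(i : ℤ)) = sqrtCoeff X i := by simp [hs]
        have b2 : X.sqrt (1 - r - -(i : ℤ)) = sqrtCoeff X (r - 1 - i) := by
          rw [hs, if_pos (by omega)]
          congr 1
          omega
        rw [b1, b2]
      rw [a3, a4, a1, a2, a5, shift_one]
      have key := congrArg (fun T : Module.End ℝ Fld => T (X (1 - r) -
        ∑ i : Fin r, sqrtCoeff X i * shift (-(i : ℤ)) (sqrtCoeff X (r - 1 - i))))
        shift_add_one_mul_inv
      simp only [Module.End.mul_apply, LinearMap.add_apply, Module.End.one_apply] at key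
      rw [← sqrtCoeff] at key
      linear_combination key
    · intro i _ j _ hij
      exact Fin.ext (by simpa using hij)
    · simp only [Finset.mem_image, Finset.mem_univ, true_and, not_exists]
      intro i hi
      have := i.2
      omega
    · simp only [Finset.mem_insert, Finset.mem_image, Finset.mem_univ, true_and, not_or, not_exists]
      refine ⟨by omega, fun i hi => by omega⟩
  · simp [hs, shift_one, h2]
  · rw [Finset.Icc_eq_empty (by omega), Finset.sum_empty, h3 n hn]

theorem opL_apply_of_two_le {n : ℤ} (hn : 2 ≤ n) : opL n = if n = 2 then 1 else 0 := by
  have hA : ∀ i : ℤ, opA i =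
      (if i = 2 then 1 else 0) + (if i = 1 then u else 0) + (if i = 0 then v else 0) :=
    fun _ => rfl
  rw [opL, Op.mul_apply_sum _ _ _ {0} fun i hi => by
    rw [Finset.mem_singleton] at hi
    rcases lt_or_gt_of_ne hi with hi | hi
    · right
      rw [hA, if_neg (by omega), if_neg (by omega), if_neg (by omega)]
      simp
    · left
      simp [opBInv, hi.not_ge]]
  rw [Finset.sum_singleton, shift_zero, Module.End.one_apply, hA]
  simp [opBInv, opBInvCoeff, show n ≠ 1 by omega, show n ≠ 0 by omega]

theorem opLt_apply_of_two_le {n : ℤ} (hn : 2 ≤ n) : opLt n = if n = 2 then 1 else 0 := by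
  have hA : ∀ i : ℤ, opA i =
      (if i = 2 then 1 else 0) + (if i = 1 then u else 0) + (if i = 0 then v else 0) :=
    fun _ => rfl
  rw [opLt, Op.mul_apply_sum _ _ _ {2} fun i hi => by
    rw [Finset.mem_singleton] at hi
    rcases lt_or_gt_of_ne hi with hi | hi
    · right
      simp [opBInv, show ¬ (n - i ≤ 0) by omega]
    · left
      rw [hA, if_neg (by omega), if_neg (by omega), if_neg (by omega)]
      simp]
  rw [Finset.sum_singleton, hA]
  rcases hn.eq_or_lt with rfl | hn
  · simp [opBInv, opBInvCoeff, shift_one]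
  · simp [opBInv, show ¬ (n - 2 ≤ 0) by omega, hn.ne']

theorem sqrt_opL_mul_self : opL.sqrt * opL.sqrt = opL :=
  opL.sqrt_mul_sqrt (by simp [opL_apply_of_two_le le_rfl])
    fun n hn => by simp [opL_apply_of_two_le hn.le, hn.ne']

theorem sqrt_opLt_mul_self : opLt.sqrt * opLt.sqrt = opLt :=
  opLt.sqrt_mul_sqrt (by simp [opLt_apply_of_two_le le_rfl])
    fun n hn => by simp [opLt_apply_of_two_le hn.le, hn.ne']

/-! ### The hierarchy -/

/-- The time variables `t^{2,k}`, `t^{3,k}` and `t^{0,-k-1}`, `k ≥ 0`. -/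
inductive Time : Type
  | t2 (k : ℕ)
  | t3 (k : ℕ)
  | t0 (k : ℕ)

/-- `X = (∂_t u, ∂_t v, ∂_t w)` satisfies `ε ∂_t A = c (Ỹ A - A Y)` and `ε ∂_t B = c (Ỹ B - B Y)`. -/
def LaxPair (c : ℝ) (Yt Y : Op) (X : Fin 3 → Fld) : Prop :=
  eps • Op.evol X opA = c • (Yt * opA - opA * Y) ∧
    eps • Op.evol X opB = c • (Yt * opB - opB * Y)

/-- `X = (∂_t u, ∂_t v, ∂_t w)` satisfies the equations that define the flow of the time `t` of the
rational reduction of type `(2, 1)`. -/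
def IsFlow : Time → (Fin 3 → Fld) → Prop
  | .t2 k => LaxPair ((2 : ℝ) ^ ((k : ℝ) + 1 / 2) / (Nat.doubleFactorial (2 * k + 1) : ℝ))
      (Op.sqrt opLt ^ (2 * k + 1)).pos (Op.sqrt opL ^ (2 * k + 1)).pos
  | .t3 k => LaxPair (1 / (Nat.factorial (k + 1) : ℝ))
      (opLt ^ (k + 1)).pos (opL ^ (k + 1)).pos
  | .t0 k => LaxPair ((-1 : ℝ) ^ k * (Nat.factorial k : ℝ))
      (opMt ^ (k + 1)).neg (opM ^ (k + 1)).neg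

/-! ### The Hamiltonian structure -/

/-- The density of `H_{2,j-1}`, `j ≥ 0`, a multiple of `Res L^{j + 1/2}`. -/
def ham2 (j : ℕ) : Fld :=
  ((2 : ℝ) ^ ((j : ℝ) + 1 / 2) / (Nat.doubleFactorial (2 * j + 1) : ℝ)) •
    (Op.sqrt opL ^ (2 * j + 1)).res

/-- The density of `H_{3,j-1}`, `j ≥ 0`, a multiple of `Res L^{j + 1}`. -/
def ham3 (j : ℕ) : Fld :=
  (1 / (Nat.factorial (j + 1) : ℝ)) • (opL ^ (j + 1)).res

/-- The density of `H_{0,-k-1}`, `k ≥ 0`: `log (w / v)` for `k = 0` and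
`(-1)^k (k-1)! Res M^k` for `k ≥ 1`. -/
def ham0 : ℕ → Fld
  | 0 => ofFun logWVFun
  | j + 1 => ((-1 : ℝ) ^ (j + 1) * (Nat.factorial j : ℝ)) • (opM ^ (j + 1)).res

/-- The density of the Hamiltonian of the time `t^{i,k}`. -/
def ham : Time → Fld
  | .t2 k => ham2 (k + 1)
  | .t3 k => ham3 (k + 1)
  | .t0 k => ham0 k

/-- `3 × 3` matrices of operators acting on functions. -/
abbrev OpMatrix : Type := Matrix (Fin 3) (Fin 3) (Module.End ℝ Fld)

/-- The action of a matrix of operators on a column of functions. -/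
def OpMatrix.app (P : OpMatrix) (X : Fin 3 → Fld) : Fin 3 → Fld :=
  fun α => ∑ β, P α β (X β)

/-- Multiplication by a function. -/
def mulOp (f : Fld) : Module.End ℝ Fld := LinearMap.mulLeft ℝ f

/-- The operator `𝒫₁`; products are compositions of operators. -/
def P1 : OpMatrix :=
  !![shift 1 - shift (-1), mulOp w * shift (-1) - shift 2 * mulOp w, 0;
     mulOp w * shift (-2) - shift 1 * mulOp w,
       mulOp w * shift (-1) * mulOp u - mulOp u * shift 1 * mulOp w, (shift 1 - 1) * mulOp w;
     0, mulOp w * (1 - shift (-1)), 0]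

/-- The density of the bracket `{F, G} = ∫ ∑ (δF/δu^α) P^{αβ} (δG/δu^β) dx` of the local functionals
with densities `f` and `g`. -/
def bracket (P : OpMatrix) (f g : Fld) : Fld :=
  ∑ α, varDeriv f α * P.app (varDeriv g) α

/-- `∫ f dx = 0`, that is, `f` is a total derivative. -/
def IntegralZero (f : Fld) : Prop := f ∈ LinearMap.range dX

/-- `P` is a Hamiltonian operator: it is skew-adjoint and its bracket of local functionals satisfies
the Jacobi identity. -/
structure IsHamiltonian (P : OpMatrix) : Prop where
  skew : ∀ X Y : Fin 3 → Fld, IntegralZero (∑ α, (X α * P.app Y α + Y α * P.app X α))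
  jacobi : ∀ f g h : Fld, IntegralZero
    (bracket P (bracket P f g) h + bracket P (bracket P g h) f + bracket P (bracket P h f) g)

end

end RR2T

namespace RR2T

noncomputable section

/-! ### Partial derivatives as derivations -/

/-! Hamiltonian property. Since Λ^n f - f is a total derivative, integrals are shift invariant, and
skew-adjointness becomes a list of terms f - Λ^n f (`intg_P1_skew`). For Jacobi, {{F,G},H} is the
derivative of {F,G} along the vector field of H. The second variations are symmetric and cancel in
the cyclic sum. What remains is the cyclic sum of ∫ δF · (D𝒫₁)(δG), with D the derivative along the
field of H. Once each monomial is shifted so that its least shift is zero, that sum vanishes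
identically (`intg_dP1_cyclic`).

Lax equations. All flows are written with one operator Q satisfying BQA = AQB, with generators
(BQ)_+ and (QB)_+. Without truncation both equations read 0 = 0, so only the terms cut off by the
truncation survive. They sit at orders 1, 0 of A and -1 of B, and they are 𝒫₁ applied to (ΛQ_{-1},
Q_0, ρ) as soon as (Λ-1)(wρ) = (AQ)_0 - (QA)_0 (`laxPair_pos_iff`). If R satisfies BR = AQ and RB =
QA, then ρ = Λ^{-1}R_1 has this property. The same triple is the variational derivative of any
functional with first variation ∫ Res(Q δA - R δB) (`laxPair_iff_of_variation`).

Such functionals come from the cyclic trace ∫ Res: δ∫Res L^{n+1} = (n+1)∫Res L^n δL, where BL = A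
gives δL = B^{-1}(δA - δB L). Here Q = N B^{-1} for a power N of L or of its square root. For M one
takes Q = -M^k A^{-1}, and negative parts are exchanged for positive ones. The case of log(w/v) is
checked by hand.

Variational derivatives are determined by first variations because the pairing ∫ fg is nondegenerate
(`eq_zero_of_forall_mul_mem_range`). The flow exists and is unique because 𝒫₁ vanishes at ε = 0, so
that its values can be divided by ε. -/

theorem partialFun_apply (α : Fin 3) (f : SmoothFun) (p : dom) :
    (partialFun α f).1 p = fderiv ℝ (ext0 f.1) p.1 (Pi.single α 1) := rfl

theorem partialFun_mul (α : Fin 3) (f g : SmoothFun) :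
    partialFun α (f * g) = f * partialFun α g + g * partialFun α f := by
  refine Subtype.ext (funext fun p => ?_)
  have h : ext0 (f.1 * g.1) = ext0 f.1 * ext0 g.1 := by
    funext q; by_cases hq : q ∈ dom <;> simp [ext0, hq]
  change fderiv ℝ (ext0 (f.1 * g.1)) p.1 _ =
    f.1 p * fderiv ℝ (ext0 g.1) p.1 _ + g.1 p * fderiv ℝ (ext0 f.1) p.1 _
  rw [h, fderiv_mul (differentiableAt_ext0 f p) (differentiableAt_ext0 g p)]
  simp [ext0_apply _ p.2]

theorem ext0_partialFun_eventuallyEq (α : Fin 3) (f : SmoothFun) (p : dom) :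
    ext0 (partialFun α f).1 =ᶠ[nhds p.1] fun q => fderiv ℝ (ext0 f.1) q (Pi.single α 1) := by
  filter_upwards [isOpen_dom.mem_nhds p.2] with q hq
  rw [ext0_apply _ hq, partialFun_apply]

theorem partialFun_comm (α β : Fin 3) (f : SmoothFun) :
    partialFun α (partialFun β f) = partialFun β (partialFun α f) := by
  refine Subtype.ext (funext fun p => ?_)
  have hf : ContDiffAt ℝ ∞ (ext0 f.1) p.1 :=
    (f.2 : ContDiffOn ℝ ∞ (ext0 f.1) dom).contDiffAt (isOpen_dom.mem_nhds p.2)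
  have hd : DifferentiableAt ℝ (fderiv ℝ (ext0 f.1)) p.1 :=
    (hf.fderiv_right (m := ∞) (by simp)).differentiableAt (by simp)
  have hs : IsSymmSndFDerivAt ℝ (ext0 f.1) p.1 :=
    hf.isSymmSndFDerivAt (by
      rw [minSmoothness_of_isRCLikeNormedField]
      exact WithTop.coe_le_coe.mpr (le_top : (2 : ℕ∞) ≤ ⊤))
  have key : ∀ γ δ : Fin 3, (partialFun γ (partialFun δ f)).1 p =
      fderiv ℝ (fderiv ℝ (ext0 f.1)) p.1 (Pi.single γ 1) (Pi.single δ 1) := by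
    intro γ δ
    rw [partialFun_apply, (ext0_partialFun_eventuallyEq δ f p).fderiv_eq,
      fderiv_clm_apply hd (differentiableAt_const _)]
    simp
  change (partialFun α (partialFun β f)).1 p = (partialFun β (partialFun α f)).1 p
  rw [key, key, hs.eq]

theorem partialFun_mkSmooth (α : Fin 3) (f : (Fin 3 → ℝ) → ℝ) (hf : ContDiffOn ℝ ∞ f dom)
    (p : dom) : (partialFun α (mkSmooth f hf)).1 p = fderiv ℝ f p.1 (Pi.single α 1) := by
  rw [partialFun_apply]
  have h : ext0 (mkSmooth f hf).1 =ᶠ[nhds p.1] f := by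
    filter_upwards [isOpen_dom.mem_nhds p.2] with q hq
    rw [ext0_apply _ hq]
    rfl
  rw [h.fderiv_eq]

theorem partialFun_coordFun (α β : Fin 3) :
    partialFun α (coordFun β) = if β = α then 1 else 0 := by
  refine Subtype.ext (funext fun p => ?_)
  rw [coordFun, partialFun_mkSmooth]
  have h : fderiv ℝ (fun q : Fin 3 → ℝ => q β) p.1 =
      ContinuousLinearMap.proj (R := ℝ) (φ := fun _ : Fin 3 => ℝ) β :=
    (ContinuousLinearMap.proj (R := ℝ) (φ := fun _ : Fin 3 => ℝ) β).fderiv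
  rw [h]
  split_ifs with hh
  · subst hh
    simp only [ContinuousLinearMap.proj_apply, Pi.single_eq_same]
    rfl
  · simp only [ContinuousLinearMap.proj_apply]
    rw [Pi.single_eq_of_ne hh]
    rfl

theorem coeff_mapCoeffs (D : SmoothFun →ₗ[ℝ] SmoothFun) (p : DiffPoly) (n : Fin 3 × ℕ →₀ ℕ) :
    (mapCoeffs D p).coeff n = D (p.coeff n) := by
  classical
  change (∑ m ∈ p.support, MvPolynomial.monomial m (D (p.coeff m))).coeff n = D (p.coeff n)
  simp only [MvPolynomial.coeff_sum, MvPolynomial.coeff_monomial]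
  rw [Finset.sum_ite_eq' p.support n]
  split_ifs with h
  · rfl
  · rw [MvPolynomial.notMem_support_iff.mp h, map_zero]

theorem mapCoeffs_monomial (D : SmoothFun →ₗ[ℝ] SmoothFun) (m : Fin 3 × ℕ →₀ ℕ) (a : SmoothFun) :
    mapCoeffs D (MvPolynomial.monomial m a) = MvPolynomial.monomial m (D a) := by
  classical
  ext1 n
  rw [coeff_mapCoeffs, MvPolynomial.coeff_monomial, MvPolynomial.coeff_monomial]
  split_ifs <;> simp

theorem mapCoeffs_C (D : SmoothFun →ₗ[ℝ] SmoothFun) (a : SmoothFun) :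
    mapCoeffs D (MvPolynomial.C a) = MvPolynomial.C (D a) := mapCoeffs_monomial D 0 a

theorem mapCoeffs_mul (D : SmoothFun →ₗ[ℝ] SmoothFun)
    (hD : ∀ f g, D (f * g) = f * D g + g * D f) (p q : DiffPoly) :
    mapCoeffs D (p * q) = p * mapCoeffs D q + q * mapCoeffs D p := by
  induction p using MvPolynomial.induction_on' with
  | add p₁ p₂ h₁ h₂ => rw [add_mul, map_add, h₁, h₂, map_add]; ring
  | monomial m a =>
    induction q using MvPolynomial.induction_on' with
    | add q₁ q₂ h₁ h₂ => rw [mul_add, map_add, h₁, h₂, map_add]; ring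
    | monomial n b =>
      simp only [MvPolynomial.monomial_mul, mapCoeffs_monomial, hD, map_add, add_comm n m]

theorem pd_mul (α : Fin 3) (s : ℕ) (p q : DiffPoly) :
    pd α s (p * q) = p * pd α s q + q * pd α s p := by
  cases s with
  | zero => exact mapCoeffs_mul _ (partialFun_mul α) p q
  | succ s => exact (MvPolynomial.pderiv (α, s)).leibniz p q

/-- The partial derivative `∂ / ∂u^{α,s}` as a derivation. -/
def pdD (α : Fin 3) (s : ℕ) : Derivation ℝ DiffPoly DiffPoly :=
  Derivation.mk' (pd α s) (pd_mul α s)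

theorem pdD_apply (α : Fin 3) (s : ℕ) (p : DiffPoly) : pdD α s p = pd α s p := rfl

theorem pd_zero_C (α : Fin 3) (f : SmoothFun) :
    pd α 0 (MvPolynomial.C f) = MvPolynomial.C (partialFun α f) := mapCoeffs_C _ f

theorem pd_succ_C (α : Fin 3) (s : ℕ) (f : SmoothFun) :
    pd α (s + 1) (MvPolynomial.C f) = 0 := MvPolynomial.pderiv_C

theorem pd_zero_X (α : Fin 3) (i : Fin 3 × ℕ) : pd α 0 (MvPolynomial.X i) = 0 := by
  change mapCoeffs _ (MvPolynomial.monomial _ 1) = 0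
  rw [mapCoeffs_monomial, partialFun_one, map_zero]

theorem pd_succ_X (α : Fin 3) (s : ℕ) (i : Fin 3 × ℕ) :
    pd α (s + 1) (MvPolynomial.X i) = if i = (α, s) then 1 else 0 := by
  change MvPolynomial.pderiv (α, s) (MvPolynomial.X i) = _
  split_ifs with h
  · rw [h, MvPolynomial.pderiv_X_self]
  · exact MvPolynomial.pderiv_X_of_ne h

/-- All of C^∞(dom) must be tested: an ℝ-derivation of smooth functions is not determined
algebraically by its values on the three coordinates. Identities between vector fields are proved
below by comparing both sides on these generators. -/
theorem diffPoly_derivation_ext {D E : Derivation ℝ DiffPoly DiffPoly}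
    (hC : ∀ f, D (MvPolynomial.C f) = E (MvPolynomial.C f))
    (hX : ∀ i, D (MvPolynomial.X i) = E (MvPolynomial.X i)) : D = E := by
  ext1 p
  induction p using MvPolynomial.induction_on with
  | C a => exact hC a
  | add p q hp hq => rw [map_add, map_add, hp, hq]
  | mul_X p i hp => rw [Derivation.leibniz, Derivation.leibniz, hp, hX]

theorem pd_comm (α β : Fin 3) (s r : ℕ) (p : DiffPoly) :
    pd α s (pd β r p) = pd β r (pd α s p) := by
  have h : ⁅pdD α s, pdD β r⁆ = 0 := by
    refine diffPoly_derivation_ext (fun f => ?_) fun i => ?_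
    · rw [Derivation.commutator_apply]
      simp only [pdD_apply]
      rcases s with _ | s <;> rcases r with _ | r <;>
        simp [pd_zero_C, pd_succ_C, partialFun_comm α β]
    · rw [Derivation.commutator_apply]
      have h1 : ∀ (γ : Fin 3) (k : ℕ), pd γ k 1 = 0 := fun γ k => (pdD γ k).map_one_eq_zero
      simp only [pdD_apply]
      rcases s with _ | s <;> rcases r with _ | r <;>
        simp only [pd_zero_X, pd_succ_X, map_zero, sub_self] <;>
        (try split_ifs) <;> simp [h1]
  have := congrArg (fun D : Derivation ℝ DiffPoly DiffPoly => D p) h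
  simpa [Derivation.commutator_apply, pdD_apply, sub_eq_zero] using this

/-! ### The total derivative and evolutionary vector fields on differential polynomials -/

theorem finite_support_pd (α : Fin 3) (p : DiffPoly) :
    (Function.support fun s => pd α s p).Finite := by
  classical
  -- `vars` sees only the jets of positive order; dependence on the order-zero variables is hidden
  -- in the coefficients, hence the extra `{0}`.
  refine ((p.vars.image fun i => i.2 + 1) ∪ {0}).finite_toSet.subset fun s hs => ?_
  rcases s with _ | s
  · simp
  · have h : (α, s) ∈ p.vars := by
      by_contra h
      exact hs (MvPolynomial.pderiv_eq_zero_of_notMem_vars h)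
    simp only [Finset.coe_union, Set.mem_union, Finset.mem_coe, Finset.mem_image]
    exact Or.inl ⟨_, h, rfl⟩

/-- A `C^∞(dom)`-linear derivation of the differential polynomials, over `ℝ`. -/
def restrictDer (D : Derivation SmoothFun DiffPoly DiffPoly) : Derivation ℝ DiffPoly DiffPoly :=
  Derivation.mk' (D.toLinearMap.restrictScalars ℝ) D.leibniz

/-- The evolutionary vector field with characteristic `x`, and with values `y` on the jet variables of
positive order. -/
def jetDer (x : Fin 3 → DiffPoly) (y : Fin 3 × ℕ → DiffPoly) : Derivation ℝ DiffPoly DiffPoly :=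
  (∑ α, x α • pdD α 0) + restrictDer (MvPolynomial.mkDerivation SmoothFun y)

theorem jetDer_C (x : Fin 3 → DiffPoly) (y : Fin 3 × ℕ → DiffPoly) (f : SmoothFun) :
    jetDer x y (MvPolynomial.C f) = ∑ α, x α * MvPolynomial.C (partialFun α f) := by
  have h : restrictDer (MvPolynomial.mkDerivation SmoothFun y) (MvPolynomial.C f) = 0 :=
    MvPolynomial.derivation_C _ f
  rw [jetDer, Derivation.add_apply, h, add_zero, Fin.sum_univ_three, Fin.sum_univ_three]
  simp only [Derivation.add_apply, Derivation.smul_apply, pdD_apply, pd_zero_C, smul_eq_mul]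

theorem jetDer_X (x : Fin 3 → DiffPoly) (y : Fin 3 × ℕ → DiffPoly) (i : Fin 3 × ℕ) :
    jetDer x y (MvPolynomial.X i) = y i := by
  have h : restrictDer (MvPolynomial.mkDerivation SmoothFun y) (MvPolynomial.X i) = y i :=
    MvPolynomial.mkDerivation_X _ y i
  rw [jetDer, Derivation.add_apply, h, Fin.sum_univ_three]
  simp only [Derivation.add_apply, Derivation.smul_apply, pdD_apply, pd_zero_X]
  simp

/-- The total derivative as a derivation. -/
def dxD : Derivation ℝ DiffPoly DiffPoly :=
  jetDer (fun α => jet α 1) fun i => jet i.1 (i.2 + 2)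

theorem dxD_apply (p : DiffPoly) : dxD p = dx p := by
  simp only [dxD, jetDer, dx, Fin.sum_univ_three]
  rfl

theorem dx_mul (p q : DiffPoly) : dx (p * q) = p * dx q + q * dx p := by
  simpa only [dxD_apply, smul_eq_mul] using dxD.leibniz p q

theorem dx_C (f : SmoothFun) :
    dx (MvPolynomial.C f) = ∑ α, MvPolynomial.X (α, 0) * MvPolynomial.C (partialFun α f) := by
  rw [← dxD_apply, dxD, jetDer_C]
  rfl

theorem dx_X (i : Fin 3 × ℕ) : dx (MvPolynomial.X i) = MvPolynomial.X (i.1, i.2 + 1) := by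
  rw [← dxD_apply, dxD, jetDer_X]
  rfl

/-- The commutator of two derivations is a derivation, so it is enough to compare on generators.
This relation is what detects the top jet variable of a total derivative. -/
theorem pd_succ_dx (α : Fin 3) (s : ℕ) (p : DiffPoly) :
    pd α (s + 1) (dx p) = dx (pd α (s + 1) p) + pd α s p := by
  have h : ⁅pdD α (s + 1), dxD⁆ = pdD α s := by
    refine diffPoly_derivation_ext (fun f => ?_) fun i => ?_
    · simp only [Derivation.commutator_apply, pdD_apply, dxD_apply, dx_C, pd_succ_C, map_sum,
        pd_mul, pd_succ_X, mul_zero, map_zero, zero_add, sub_zero]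
      rcases s with _ | s
      · rw [pd_zero_C, Finset.sum_eq_single α]
        · simp
        · intro β _ hb
          simp [hb]
        · simp
      · rw [pd_succ_C]
        simp
    · simp only [Derivation.commutator_apply, pdD_apply, dxD_apply, dx_X, pd_succ_X]
      have h0 : dx (if i = (α, s) then 1 else 0) = 0 := by split_ifs <;> simp [dx_one]
      rw [h0, sub_zero]
      obtain ⟨β, j⟩ := i
      rcases s with _ | s
      · simp [pd_zero_X]
      · simp [pd_succ_X]
  have := congrArg (fun D : Derivation ℝ DiffPoly DiffPoly => D p) h
  rw [Derivation.commutator_apply] at this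
  simp only [pdD_apply, dxD_apply] at this
  rw [← this]
  ring

/-- The evolutionary vector field with characteristic `x`. -/
def evD (x : Fin 3 → DiffPoly) : Derivation ℝ DiffPoly DiffPoly :=
  jetDer x fun i => (dx ^ (i.2 + 1)) (x i.1)

theorem evD_C (x : Fin 3 → DiffPoly) (f : SmoothFun) :
    evD x (MvPolynomial.C f) = ∑ α, x α * MvPolynomial.C (partialFun α f) := jetDer_C _ _ f

theorem evD_X (x : Fin 3 → DiffPoly) (i : Fin 3 × ℕ) :
    evD x (MvPolynomial.X i) = (dx ^ (i.2 + 1)) (x i.1) := jetDer_X _ _ i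

theorem evD_dx (x : Fin 3 → DiffPoly) (p : DiffPoly) : evD x (dx p) = dx (evD x p) := by
  have h : ⁅evD x, dxD⁆ = 0 := by
    refine diffPoly_derivation_ext (fun f => ?_) fun i => ?_
    · simp only [Derivation.commutator_apply, dxD_apply, dx_C, evD_C, map_sum,
        Derivation.leibniz, evD_X, smul_eq_mul, Finset.mul_sum, Finset.sum_add_distrib]
      rw [Finset.sum_comm]
      simp only [zero_add, pow_one, partialFun_comm _, Derivation.zero_apply]
      rw [sub_eq_zero]
      congr 1
      · refine Finset.sum_congr rfl fun α _ => Finset.sum_congr rfl fun β _ => ?_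
        rw [partialFun_comm α β]
        ring
    · simp only [Derivation.commutator_apply, dxD_apply, dx_X, evD_X]
      rw [pow_succ' dx (i.2 + 1)]
      simp
  have := congrArg (fun D : Derivation ℝ DiffPoly DiffPoly => D p) h
  simpa [Derivation.commutator_apply, dxD_apply, sub_eq_zero] using this

theorem evD_dx_pow (x : Fin 3 → DiffPoly) (k : ℕ) (p : DiffPoly) :
    evD x ((dx ^ k) p) = (dx ^ k) (evD x p) := by
  induction k with
  | zero => simp
  | succ k ih => rw [pow_succ', Module.End.mul_apply, Module.End.mul_apply, evD_dx, ih]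

theorem evD_commutator (x y : Fin 3 → DiffPoly) (p : DiffPoly) :
    evD x (evD y p) - evD y (evD x p) = evD (fun α => evD x (y α) - evD y (x α)) p := by
  rw [← Derivation.commutator_apply]
  refine congrArg (fun D : Derivation ℝ DiffPoly DiffPoly => D p)
    (diffPoly_derivation_ext (fun f => ?_) fun i => ?_)
  · simp only [Derivation.commutator_apply, evD_C, map_sum,
      Derivation.leibniz, smul_eq_mul, Finset.mul_sum, Finset.sum_add_distrib, sub_mul,
      Finset.sum_sub_distrib]
    rw [Finset.sum_comm (f := fun a b => x a * (y b * _))]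
    have h : ∀ a b : Fin 3, x b * (y a * MvPolynomial.C (partialFun a (partialFun b f))) =
        y a * (x b * MvPolynomial.C (partialFun b (partialFun a f))) := fun a b => by
      rw [partialFun_comm a b]; ring
    simp only [h, mul_comm (MvPolynomial.C _) _]
    ring
  · simp only [Derivation.commutator_apply, evD_X, evD_dx_pow, map_sub]

/-- Connects the derivation `evD`, convenient for algebra, with the sum over jets in the definition
of `evol`. Both sides obey the Leibniz rule in `p` and agree on generators. -/
theorem evD_eq_finsum (x : Fin 3 → DiffPoly) (p : DiffPoly) :
    evD x p = ∑ α, ∑ᶠ s : ℕ, (dx ^ s) (x α) * pd α s p := by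
  have hfin : ∀ (α : Fin 3) (q r : DiffPoly),
      (Function.support fun s => q * ((dx ^ s) (x α) * pd α s r)).Finite := fun α q r =>
    (finite_support_pd α r).subset fun s hs h => hs (by simp only at h ⊢; rw [h]; simp)
  have hfin' : ∀ (α : Fin 3) (r : DiffPoly),
      (Function.support fun s => (dx ^ s) (x α) * pd α s r).Finite := fun α r => by
    simpa using hfin α 1 r
  have hmul : ∀ p q : DiffPoly, (∑ α, ∑ᶠ s : ℕ, (dx ^ s) (x α) * pd α s (p * q)) =
      p * (∑ α, ∑ᶠ s : ℕ, (dx ^ s) (x α) * pd α s q) +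
      q * (∑ α, ∑ᶠ s : ℕ, (dx ^ s) (x α) * pd α s p) := by
    intro p q
    rw [Finset.mul_sum, Finset.mul_sum, ← Finset.sum_add_distrib]
    refine Finset.sum_congr rfl fun α _ => ?_
    rw [mul_finsum' _ _ (hfin' α q), mul_finsum' _ _ (hfin' α p),
      ← finsum_add_distrib (hfin α p q) (hfin α q p)]
    refine finsum_congr fun s => ?_
    rw [pd_mul]
    ring
  have hX : ∀ i, evD x (MvPolynomial.X i) =
      ∑ α, ∑ᶠ s : ℕ, (dx ^ s) (x α) * pd α s (MvPolynomial.X i) := by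
    rintro ⟨β, j⟩
    rw [evD_X, Finset.sum_eq_single β, finsum_eq_single _ (j + 1)]
    · rw [pd_succ_X, if_pos rfl, mul_one]
    · rintro (_ | s) hs
      · rw [pd_zero_X, mul_zero]
      · rw [pd_succ_X, if_neg (by simp; omega), mul_zero]
    · intro α _ hα
      rw [← finsum_zero (α := ℕ)]
      refine finsum_congr fun s => ?_
      rcases s with _ | s
      · rw [pd_zero_X, mul_zero]
      · rw [pd_succ_X, if_neg (by simp; tauto), mul_zero]
    · simp
  induction p using MvPolynomial.induction_on with
  | C f =>
    rw [evD_C]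
    refine Finset.sum_congr rfl fun α _ => ?_
    rw [finsum_eq_single _ 0]
    · rw [pd_zero_C, pow_zero, Module.End.one_apply]
    · rintro (_ | s) hs
      · exact absurd rfl hs
      · rw [pd_succ_C, mul_zero]
  | add p q hp hq =>
    rw [map_add, hp, hq, ← Finset.sum_add_distrib]
    refine Finset.sum_congr rfl fun α _ => ?_
    rw [← finsum_add_distrib (hfin' α p) (hfin' α q)]
    exact finsum_congr fun s => by rw [map_add, mul_add]
  | mul_X p i hp =>
    rw [Derivation.leibniz, hmul, hp, hX]
    rfl

theorem evD_add (x y : Fin 3 → DiffPoly) (p : DiffPoly) :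
    evD (x + y) p = evD x p + evD y p := by
  rw [← Derivation.add_apply]
  refine congrArg (fun D : Derivation ℝ DiffPoly DiffPoly => D p)
    (diffPoly_derivation_ext (fun f => ?_) fun i => ?_)
  · simp only [Derivation.add_apply, evD_C, Pi.add_apply, add_mul, Finset.sum_add_distrib]
  · simp only [Derivation.add_apply, evD_X, Pi.add_apply, map_add]

/-- The evolutionary vector field as an additive function of its characteristic. -/
def evDHom (p : DiffPoly) : (Fin 3 → DiffPoly) →+ DiffPoly :=
  AddMonoidHom.mk' (fun x => evD x p) fun x y => evD_add x y p

theorem evD_sum {ι : Type*} (t : Finset ι) (x : ι → Fin 3 → DiffPoly) (p : DiffPoly) :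
    evD (∑ i ∈ t, x i) p = ∑ i ∈ t, evD (x i) p := map_sum (evDHom p) x t

/-! ### Integration by parts and nondegeneracy -/

theorem dx_pow_mul_sub_mem_range (s : ℕ) (p q : DiffPoly) :
    (dx ^ s) p * q - p * ((-dx) ^ s) q ∈ LinearMap.range dx := by
  induction s generalizing p q with
  | zero => simp
  | succ s ih =>
    have h1 := ih (dx p) q
    have h2 : (dx ^ (s + 1)) p * q - p * ((-dx) ^ (s + 1)) q =
        ((dx ^ s) (dx p) * q - dx p * ((-dx) ^ s) q) + dx (p * ((-dx) ^ s) q) := by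
      rw [dx_mul, pow_succ dx, pow_succ' (-dx), Module.End.mul_apply, Module.End.mul_apply,
        LinearMap.neg_apply]
      ring
    rw [h2]
    exact Submodule.add_mem _ h1 ⟨_, rfl⟩

/-- First variation formula: integration by parts in each of the finitely many nonzero terms. -/
theorem evD_sub_mem_range (x : Fin 3 → DiffPoly) (p : DiffPoly) :
    evD x p - ∑ α, x α * ∑ᶠ s : ℕ, ((-dx) ^ s) (pd α s p) ∈ LinearMap.range dx := by
  rw [evD_eq_finsum, ← Finset.sum_sub_distrib]
  refine Submodule.sum_mem _ fun α _ => ?_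
  have hf := finite_support_pd α p
  rw [finsum_eq_sum_of_support_subset (s := hf.toFinset) _ fun s hs => ?_,
    finsum_eq_sum_of_support_subset (s := hf.toFinset) _ fun s hs => ?_, Finset.mul_sum,
    ← Finset.sum_sub_distrib]
  · exact Submodule.sum_mem _ fun s _ => dx_pow_mul_sub_mem_range s _ _
  · simp only [Set.Finite.coe_toFinset]
    exact fun h => hs (by simp only at h ⊢; rw [h, map_zero])
  · simp only [Set.Finite.coe_toFinset]
    exact fun h => hs (by simp only at h ⊢; rw [h, mul_zero])

/-- A total derivative is at most linear in its highest jet variable, whereas multiplying `g` by the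
square of a jet variable of higher order gives something quadratic unless `g = 0`. -/
theorem eq_zero_of_forall_mul_mem_range (g : DiffPoly)
    (h : ∀ p, p * g ∈ LinearMap.range dx) : g = 0 := by
  obtain ⟨s, hs⟩ : ∃ s : ℕ, ∀ r, s ≤ r → pd 0 r g = 0 := by
    obtain ⟨s, hs⟩ := (finite_support_pd 0 g).bddAbove
    refine ⟨s + 1, fun r hr => ?_⟩
    by_contra hne
    have := hs (show r ∈ _ from hne)
    omega
  -- `X (0, s)` is the jet variable of order s + 1, on which `g` does not depend.
  obtain ⟨p, hp⟩ := h (MvPolynomial.X (0, s) * MvPolynomial.X (0, s))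
  have hX : ∀ r, pd 0 (r + 1) (MvPolynomial.X (0, s) : DiffPoly) = if s = r then 1 else 0 := by
    intro r; rw [pd_succ_X]; simp
  -- If `p` contained a jet of order above s, its derivative would contain one of order above s + 1,
  -- but the product does not.
  have hz : ∀ r, s ≤ r → pd 0 (r + 1) p = 0 := by
    by_contra! hne
    obtain ⟨r, hr, hne⟩ := hne
    obtain ⟨N, hN⟩ := (finite_support_pd 0 p).bddAbove
    have hmax : ∃ t, s ≤ t ∧ pd 0 (t + 1) p ≠ 0 ∧ pd 0 (t + 2) p = 0 := by
      by_contra! hcon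
      have hall : ∀ k, pd 0 (r + k + 1) p ≠ 0 := by
        intro k
        induction k with
        | zero => exact hne
        | succ k ih => exact hcon (r + k) (by omega) ih
      have := hN (show r + N + 1 ∈ _ from hall N)
      omega
    obtain ⟨t, ht, h1, h2⟩ := hmax
    have h3 := pd_succ_dx 0 (t + 1) p
    rw [h2, map_zero, zero_add, hp, pd_mul, pd_mul, hX, if_neg (by omega),
      hs _ (by omega)] at h3
    exact h1 (by rw [← h3]; ring)
  -- Differentiating by the variable of order s + 1 expresses 2 X g as a derivative of `p`, which is
  -- free of that variable; a second differentiation leaves 2 g = 0.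
  have h1 := pd_succ_dx 0 s p
  rw [hz s le_rfl, map_zero, zero_add, hp, pd_mul, pd_mul, hX, if_pos rfl, hs _ (by omega)] at h1
  have h2 : pd 0 (s + 1) (pd 0 s p) = 0 := by rw [pd_comm, hz s le_rfl, map_zero]
  rw [← h1] at h2
  simp only [mul_zero, zero_add, mul_one, pd_mul, map_add, hX, if_true, hs (s + 1) (by omega)] at h2
  have h3 : (2 : ℝ) • g = 0 := by
    rw [two_smul, ← h2]; ring
  exact (smul_eq_zero.mp h3).resolve_left two_ne_zero

/-! ### Operators on series that commute with multiplication by `ε` -/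

theorem fld_eq_eps_mul_add (f : Fld) :
    f = eps * PowerSeries.mk (fun n => PowerSeries.coeff (n + 1) f) +
      PowerSeries.C (PowerSeries.coeff 0 f) := by
  rw [PowerSeries.coeff_zero_eq_constantCoeff_apply]
  exact PowerSeries.eq_X_mul_shift_add_const f

theorem coeff_zero_eps_mul (f : Fld) : PowerSeries.coeff 0 (eps * f) = 0 := by
  simp [eps]

theorem coeff_succ_eps_mul (n : ℕ) (f : Fld) :
    PowerSeries.coeff (n + 1) (eps * f) = PowerSeries.coeff n f :=
  PowerSeries.coeff_succ_X_mul n f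

theorem eps_mul_left_cancel {f g : Fld} (h : eps * f = eps * g) : f = g := by
  ext1 n
  rw [← coeff_succ_eps_mul, h, coeff_succ_eps_mul]

/-- Two additive maps that commute with `ε` and agree on constant series are equal. -/
theorem eps_ext {S T : Fld → Fld} (hS : ∀ f g, S (f + g) = S f + S g)
    (hT : ∀ f g, T (f + g) = T f + T g) (hSe : ∀ f, S (eps * f) = eps * S f)
    (hTe : ∀ f, T (eps * f) = eps * T f)
    (h : ∀ a, S (PowerSeries.C a) = T (PowerSeries.C a)) (f : Fld) : S f = T f := by
  ext1 n
  induction n generalizing f with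
  | zero =>
    rw [fld_eq_eps_mul_add f, hS, hT, hSe, hTe, h, map_add, map_add, coeff_zero_eps_mul,
      coeff_zero_eps_mul]
  | succ n ih =>
    rw [fld_eq_eps_mul_add f, hS, hT, hSe, hTe, h, map_add, map_add, coeff_succ_eps_mul,
      coeff_succ_eps_mul, ih]

theorem coeff_dX (n : ℕ) (f : Fld) : PowerSeries.coeff n (dX f) = dx (PowerSeries.coeff n f) := by
  simp [dX]

theorem coeff_dX_pow (n k : ℕ) (f : Fld) :
    PowerSeries.coeff n ((dX ^ k) f) = (dx ^ k) (PowerSeries.coeff n f) := by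
  induction k with
  | zero => simp
  | succ k ih => rw [pow_succ', pow_succ', Module.End.mul_apply, coeff_dX, ih, Module.End.mul_apply]

theorem dX_eps_mul (f : Fld) : dX (eps * f) = eps * dX f := by
  ext1 n
  rcases n with _ | n
  · rw [coeff_dX, coeff_zero_eps_mul, coeff_zero_eps_mul, map_zero]
  · rw [coeff_dX, coeff_succ_eps_mul, coeff_succ_eps_mul, coeff_dX]

theorem coeff_symb (φ : PowerSeries ℝ) (n : ℕ) (f : Fld) :
    PowerSeries.coeff n (symb φ f) = ∑ ij ∈ Finset.HasAntidiagonal.antidiagonal n,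
      PowerSeries.coeff ij.1 φ • (dx ^ ij.1) (PowerSeries.coeff ij.2 f) := by
  simp [symb]

theorem symb_C_apply (c : ℝ) (f : Fld) : symb (PowerSeries.C c) f = c • f := by
  ext1 n
  rw [coeff_symb, Finset.sum_eq_single (0, n)]
  · simp
  · rintro ⟨a, b⟩ h h'
    have : a ≠ 0 := by
      rintro rfl
      simp_all
    simp [PowerSeries.coeff_C, this]
  · simp

theorem symb_X_apply (f : Fld) : symb PowerSeries.X f = eps * dX f := by
  ext1 n
  rcases n with _ | n
  · simp [coeff_symb, eps]
  · rw [coeff_symb, coeff_succ_eps_mul, coeff_dX, Finset.sum_eq_single (1, n)]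
    · simp
    · rintro ⟨a, b⟩ h h'
      have : a ≠ 1 := by
        rintro rfl
        simp only [Finset.HasAntidiagonal.mem_antidiagonal] at h
        exact h' (by ext <;> simp; omega)
      simp [PowerSeries.coeff_X, this]
    · simp [Finset.HasAntidiagonal.mem_antidiagonal, add_comm]

/-- Splitting off the constant term of φ leaves a multiple of ε. Statements about φ(ε∂_x) for all φ
can then be proved by induction on the order in ε. -/
theorem symb_eq_add (φ : PowerSeries ℝ) (f : Fld) :
    symb φ f = eps * dX (symb (PowerSeries.mk fun n => PowerSeries.coeff (n + 1) φ) f) +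
      PowerSeries.coeff 0 φ • f := by
  conv_lhs => rw [PowerSeries.eq_X_mul_shift_add_const φ]
  rw [symb_add, symb_mul, LinearMap.add_apply, Module.End.mul_apply, symb_X_apply, symb_C_apply,
    PowerSeries.coeff_zero_eq_constantCoeff_apply]

theorem symb_eps_mul (φ : PowerSeries ℝ) (f : Fld) : symb φ (eps * f) = eps * symb φ f := by
  ext1 n
  induction n generalizing φ f with
  | zero =>
    rw [symb_eq_add]
    simp only [coeff_zero_eps_mul, map_add, PowerSeries.coeff_smul, smul_zero, add_zero]
  | succ n ih =>
    rw [symb_eq_add φ, symb_eq_add φ f, mul_add, map_add, map_add, coeff_succ_eps_mul, coeff_dX, ih,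
      ← coeff_dX, dX_eps_mul, coeff_succ_eps_mul, mul_smul_comm]

/-- An `ℝ`-linear map that commutes with `ε` and with `∂_x` commutes with every `φ(ε ∂_x)`. -/
theorem map_symb {T : Fld →ₗ[ℝ] Fld} (he : ∀ f, T (eps * f) = eps * T f)
    (hd : ∀ f, T (dX f) = dX (T f)) (φ : PowerSeries ℝ) (f : Fld) :
    T (symb φ f) = symb φ (T f) := by
  ext1 n
  induction n generalizing φ f with
  | zero =>
    rw [symb_eq_add, symb_eq_add φ, map_add, he]
    simp only [map_add, coeff_zero_eps_mul, map_smul]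
  | succ n ih =>
    rw [symb_eq_add, symb_eq_add φ, map_add, he, hd]
    simp only [map_add, coeff_succ_eps_mul, map_smul, coeff_dX, ih]

/-! ### The shift operators -/

theorem shift_shift (m n : ℤ) (f : Fld) : shift m (shift n f) = shift (m + n) f := by
  rw [shift, shift, shift, ← Module.End.mul_apply, ← symb_mul, PowerSeries.exp_mul_exp_eq_exp_add,
    Int.cast_add]

theorem shift_zero_apply (f : Fld) : shift 0 f = f := by
  rw [shift_zero, Module.End.one_apply]

theorem shift_eps_mul (n : ℤ) (f : Fld) : shift n (eps * f) = eps * shift n f :=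
  symb_eps_mul _ f

/-- Leibniz rule for the divided powers ∂_x^k / k!, which makes the exponential of ε∂_x
multiplicative. -/
theorem dx_pow_mul (k : ℕ) (p q : DiffPoly) :
    (1 / (k.factorial : ℝ)) • (dx ^ k) (p * q) =
      ∑ ij ∈ Finset.HasAntidiagonal.antidiagonal k, ((1 / (ij.1.factorial : ℝ)) • (dx ^ ij.1) p) *
        ((1 / (ij.2.factorial : ℝ)) • (dx ^ ij.2) q) := by
  have h : ∀ k : ℕ, (dx ^ k) (p * q) = ∑ ij ∈ Finset.HasAntidiagonal.antidiagonal k,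
      (k.choose ij.1) • ((dx ^ ij.1) p * (dx ^ ij.2) q) := by
    intro k
    induction k with
    | zero => simp
    | succ k ih =>
      rw [Finset.sum_antidiagonal_choose_succ_nsmul
        (fun i j => (dx ^ i) p * (dx ^ j) q) k, pow_succ', Module.End.mul_apply, ih, map_sum,
        ← Finset.sum_add_distrib]
      refine Finset.sum_congr rfl fun ij hij => ?_
      have hc : k.choose ij.2 = k.choose ij.1 := by
        rw [Finset.HasAntidiagonal.mem_antidiagonal] at hij
        exact Nat.choose_symm_of_eq_add (by omega)
      rw [map_nsmul, dx_mul, hc, pow_succ', pow_succ', Module.End.mul_apply, Module.End.mul_apply,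
        mul_comm ((dx ^ ij.2) q), smul_add]
  rw [h, Finset.smul_sum]
  refine Finset.sum_congr rfl fun ij hij => ?_
  rw [Finset.HasAntidiagonal.mem_antidiagonal] at hij
  rw [smul_mul_smul_comm, ← Nat.cast_smul_eq_nsmul ℝ, smul_smul, ← hij, Nat.choose_symm_add, Nat.add_choose,
    Nat.cast_div (Nat.factorial_mul_factorial_dvd_factorial_add _ _) (by positivity)]
  congr 1
  push_cast
  field_simp

theorem coeff_shift_C (n : ℤ) (k : ℕ) (a : DiffPoly) :
    PowerSeries.coeff k (shift n (PowerSeries.C a)) =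
      (n : ℝ) ^ k • (1 / (k.factorial : ℝ)) • (dx ^ k) a := by
  rw [shift, coeff_symb, Finset.sum_eq_single (k, 0)]
  · simp [PowerSeries.coeff_exp, PowerSeries.coeff_rescale, smul_smul]
  · rintro ⟨i, j⟩ h h'
    have : j ≠ 0 := by
      rintro rfl
      simp_all
    simp [PowerSeries.coeff_C, this]
  · simp

theorem shift_mul (n : ℤ) (f g : Fld) : shift n (f * g) = shift n f * shift n g := by
  -- ε-linearity in each factor separately reduces the claim to two series constant in ε.
  refine eps_ext (S := fun f => shift n (f * g)) (T := fun f => shift n f * shift n g)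
    (fun _ _ => by simp only [add_mul, map_add]) (fun _ _ => by simp only [add_mul, map_add])
    (fun _ => by simp only [mul_assoc, shift_eps_mul])
    (fun _ => by simp only [mul_assoc, shift_eps_mul]) (fun a => ?_) f
  refine eps_ext (S := fun g => shift n (PowerSeries.C a * g))
    (T := fun g => shift n (PowerSeries.C a) * shift n g)
    (fun _ _ => by simp only [mul_add, map_add]) (fun _ _ => by simp only [mul_add, map_add])
    (fun _ => by simp only [mul_left_comm _ eps, shift_eps_mul])
    (fun _ => by simp only [mul_left_comm _ eps, shift_eps_mul]) (fun b => ?_) g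
  ext1 k
  rw [← map_mul, coeff_shift_C, PowerSeries.coeff_mul, dx_pow_mul, Finset.smul_sum]
  refine Finset.sum_congr rfl fun ij hij => ?_
  rw [Finset.HasAntidiagonal.mem_antidiagonal] at hij
  rw [coeff_shift_C, coeff_shift_C, ← hij, pow_add]
  simp only [smul_mul_assoc, mul_smul_comm, smul_smul]
  congr 1
  ring

theorem coeff_zero_shift (n : ℤ) (f : Fld) :
    PowerSeries.coeff 0 (shift n f) = PowerSeries.coeff 0 f := by
  rw [shift, symb_eq_add, map_add, coeff_zero_eps_mul]
  simp [PowerSeries.coeff_exp, PowerSeries.coeff_rescale]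

/-! ### Local functionals -/

/-- The projection `f ↦ ∫ f dx` onto local functionals. -/
def intg : Fld →ₗ[ℝ] Fld ⧸ LinearMap.range dX := (LinearMap.range dX).mkQ

theorem intg_eq_zero {f : Fld} : intg f = 0 ↔ IntegralZero f := by
  rw [intg, Submodule.mkQ_apply, Submodule.Quotient.mk_eq_zero, IntegralZero]

theorem intg_dX (f : Fld) : intg (dX f) = 0 := intg_eq_zero.mpr ⟨f, rfl⟩

/-- The symbol of Λ^n has constant term 1, so Λ^n f - f is ε∂_x of something. -/
theorem intg_shift (n : ℤ) (f : Fld) : intg (shift n f) = intg f := by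
  rw [shift, symb_eq_add, map_add, ← dX_eps_mul, intg_dX]
  simp [PowerSeries.coeff_exp, PowerSeries.coeff_rescale]

theorem integralZero_iff {f : Fld} :
    IntegralZero f ↔ ∀ n, PowerSeries.coeff n f ∈ LinearMap.range dx := by
  constructor
  · rintro ⟨g, rfl⟩ n
    exact ⟨_, (coeff_dX n g).symm⟩
  · intro h
    choose g hg using h
    refine ⟨PowerSeries.mk g, ?_⟩
    ext1 n
    rw [coeff_dX, PowerSeries.coeff_mk, hg]

theorem eq_zero_of_forall_intg_mul {g : Fld} (h : ∀ f, intg (f * g) = 0) : g = 0 := by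
  ext1 n
  refine eq_zero_of_forall_mul_mem_range _ fun p => ?_
  have := integralZero_iff.mp (intg_eq_zero.mp (h (PowerSeries.C p))) n
  rwa [PowerSeries.coeff_C_mul] at this

/-! ### Evolutionary vector fields -/

theorem coeff_evol (X : Fin 3 → Fld) (f : Fld) (n : ℕ) :
    PowerSeries.coeff n (evol X f) = ∑ ij ∈ Finset.HasAntidiagonal.antidiagonal n,
      evD (fun α => PowerSeries.coeff ij.1 (X α)) (PowerSeries.coeff ij.2 f) := by
  rw [evol, PowerSeries.coeff_mk]
  refine Finset.sum_congr rfl fun ij _ => ?_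
  rw [evD_eq_finsum]
  simp only [coeff_dX_pow]

/-- The evolutionary vector field as a linear map. -/
def evolHom (X : Fin 3 → Fld) : Fld →ₗ[ℝ] Fld where
  toFun := evol X
  map_add' f g := by
    ext1 n
    simp only [coeff_evol, map_add, Finset.sum_add_distrib]
  map_smul' c f := by
    ext1 n
    simp only [coeff_evol, PowerSeries.coeff_smul, Derivation.map_smul, Finset.smul_sum,
      RingHom.id_apply]

theorem evol_add (X : Fin 3 → Fld) (f g : Fld) : evol X (f + g) = evol X f + evol X g :=
  map_add (evolHom X) f g

theorem evol_sub (X : Fin 3 → Fld) (f g : Fld) : evol X (f - g) = evol X f - evol X g :=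
  map_sub (evolHom X) f g

theorem evol_zero (X : Fin 3 → Fld) : evol X 0 = 0 := map_zero (evolHom X)

theorem evol_smul (X : Fin 3 → Fld) (c : ℝ) (f : Fld) : evol X (c • f) = c • evol X f :=
  map_smul (evolHom X) c f

theorem evol_sum {ι : Type*} (X : Fin 3 → Fld) (t : Finset ι) (f : ι → Fld) :
    evol X (∑ i ∈ t, f i) = ∑ i ∈ t, evol X (f i) := map_sum (evolHom X) f t

theorem evol_eps_mul (X : Fin 3 → Fld) (f : Fld) : evol X (eps * f) = eps * evol X f := by
  ext1 n
  rcases n with _ | n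
  · rw [coeff_zero_eps_mul, coeff_evol]
    simp [eps]
  · rw [coeff_succ_eps_mul, coeff_evol, coeff_evol, Finset.Nat.sum_antidiagonal_succ',
      coeff_zero_eps_mul, map_zero, zero_add]
    simp only [coeff_succ_eps_mul]

theorem coeff_evol_C (X : Fin 3 → Fld) (a : DiffPoly) (n : ℕ) :
    PowerSeries.coeff n (evol X (PowerSeries.C a)) =
      evD (fun α => PowerSeries.coeff n (X α)) a := by
  rw [coeff_evol, Finset.sum_eq_single (n, 0)]
  · simp
  · rintro ⟨i, j⟩ h h'
    have : j ≠ 0 := by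
      rintro rfl
      simp_all
    simp [PowerSeries.coeff_C, this]
  · simp

theorem evol_mul (X : Fin 3 → Fld) (f g : Fld) :
    evol X (f * g) = f * evol X g + g * evol X f := by
  refine eps_ext (S := fun f => evol X (f * g)) (T := fun f => f * evol X g + g * evol X f)
    (fun _ _ => by simp only [add_mul, evol_add])
    (fun _ _ => by simp only [add_mul, mul_add, evol_add]; ring)
    (fun _ => by simp only [mul_assoc, evol_eps_mul])
    (fun _ => by simp only [evol_eps_mul]; ring) (fun a => ?_) f
  refine eps_ext (S := fun g => evol X (PowerSeries.C a * g))
    (T := fun g => PowerSeries.C a * evol X g + g * evol X (PowerSeries.C a))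
    (fun _ _ => by simp only [mul_add, evol_add])
    (fun _ _ => by simp only [add_mul, mul_add, evol_add]; ring)
    (fun _ => by simp only [mul_left_comm _ eps, evol_eps_mul])
    (fun _ => by simp only [evol_eps_mul]; ring) (fun b => ?_) g
  ext1 k
  rw [← map_mul, coeff_evol_C, map_add, PowerSeries.coeff_C_mul, PowerSeries.coeff_C_mul,
    coeff_evol_C, coeff_evol_C, Derivation.leibniz, smul_eq_mul, smul_eq_mul]

theorem evol_one (X : Fin 3 → Fld) : evol X 1 = 0 := by
  have h := evol_mul X 1 1
  rw [mul_one, one_mul] at h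
  exact left_eq_add.mp h

theorem evol_dX (X : Fin 3 → Fld) (f : Fld) : evol X (dX f) = dX (evol X f) := by
  ext1 n
  simp only [coeff_evol, coeff_dX, map_sum, evD_dx]

theorem evol_shift (X : Fin 3 → Fld) (n : ℤ) (f : Fld) :
    evol X (shift n f) = shift n (evol X f) :=
  map_symb (T := evolHom X) (evol_eps_mul X) (evol_dX X) _ f

theorem intg_evol_of_intg_eq {f g : Fld} (X : Fin 3 → Fld) (h : intg f = intg g) :
    intg (evol X f) = intg (evol X g) := by
  rw [← sub_eq_zero, ← map_sub, intg_eq_zero] at h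
  obtain ⟨k, hk⟩ := h
  rw [← sub_eq_zero, ← map_sub, ← evol_sub, ← hk, evol_dX, intg_dX]

theorem evol_ofFun_coordFun (X : Fin 3 → Fld) (α : Fin 3) :
    evol X (ofFun (coordFun α)) = X α := by
  ext1 n
  rw [ofFun, coeff_evol_C, evD_C, Finset.sum_eq_single α]
  · rw [partialFun_coordFun, if_pos rfl, map_one, mul_one]
  · intro β _ h
    rw [partialFun_coordFun, if_neg h.symm, map_zero, mul_zero]
  · simp

theorem evol_u (X : Fin 3 → Fld) : evol X u = X 0 := evol_ofFun_coordFun X 0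

theorem evol_v (X : Fin 3 → Fld) : evol X v = X 1 := evol_ofFun_coordFun X 1

theorem evol_w (X : Fin 3 → Fld) : evol X w = X 2 := evol_ofFun_coordFun X 2

theorem sum_antidiagonal_comm {M : Type*} [AddCommMonoid M] (n : ℕ) (F : ℕ → ℕ → M) :
    ∑ ij ∈ Finset.HasAntidiagonal.antidiagonal n, F ij.1 ij.2 =
      ∑ ij ∈ Finset.HasAntidiagonal.antidiagonal n, F ij.2 ij.1 :=
  (Finset.Nat.sum_antidiagonal_swap (f := fun ij : ℕ × ℕ => F ij.1 ij.2)).symm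

theorem evol_commutator (X Y : Fin 3 → Fld) (f : Fld) :
    evol X (evol Y f) - evol Y (evol X f) = evol (fun α => evol X (Y α) - evol Y (X α)) f := by
  refine eps_ext (S := fun f => evol X (evol Y f) - evol Y (evol X f))
    (T := fun f => evol (fun α => evol X (Y α) - evol Y (X α)) f)
    (fun _ _ => by simp only [evol_add]; ring) (fun _ _ => evol_add _ _ _)
    (fun _ => by simp only [evol_eps_mul, mul_sub]) (fun _ => evol_eps_mul _ _) (fun a => ?_) f
  ext1 n
  rw [map_sub, coeff_evol_C, coeff_evol, coeff_evol]
  -- One of the two convolutions is reflected so that both pair the i-th coefficient of `X` with the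
  -- j-th of `Y`; the commutator formula for differential polynomials then applies term by term.
  have h : (fun α => PowerSeries.coeff n (evol X (Y α) - evol Y (X α))) =
      ∑ ij ∈ Finset.HasAntidiagonal.antidiagonal n, fun α =>
        evD (fun α => PowerSeries.coeff ij.1 (X α)) (PowerSeries.coeff ij.2 (Y α)) -
        evD (fun α => PowerSeries.coeff ij.2 (Y α)) (PowerSeries.coeff ij.1 (X α)) := by
    funext α
    rw [map_sub, coeff_evol, coeff_evol, Finset.sum_apply, Finset.sum_sub_distrib,
      sum_antidiagonal_comm n fun i j =>
        evD (fun α => PowerSeries.coeff i (Y α)) (PowerSeries.coeff j (X α))]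
  rw [h, evD_sum, sum_antidiagonal_comm n fun i j =>
    evD (fun α => PowerSeries.coeff i (Y α)) (PowerSeries.coeff j (evol X (PowerSeries.C a))),
    ← Finset.sum_sub_distrib]
  refine Finset.sum_congr rfl fun ij _ => ?_
  rw [← evD_commutator, coeff_evol_C, coeff_evol_C]

theorem coeff_varDeriv (f : Fld) (α : Fin 3) (n : ℕ) : PowerSeries.coeff n (varDeriv f α) =
    ∑ᶠ s : ℕ, ((-dx) ^ s) (pd α s (PowerSeries.coeff n f)) := by
  rw [varDeriv, PowerSeries.coeff_mk]

theorem intg_evol (X : Fin 3 → Fld) (f : Fld) :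
    intg (evol X f) = intg (∑ α, X α * varDeriv f α) := by
  rw [← sub_eq_zero, ← map_sub, intg_eq_zero, integralZero_iff]
  intro n
  simp only [map_sub, map_sum, coeff_evol, PowerSeries.coeff_mul, coeff_varDeriv]
  rw [Finset.sum_comm, ← Finset.sum_sub_distrib]
  exact Submodule.sum_mem _ fun ij _ => evD_sub_mem_range _ _

/-- The variational derivative is determined by the first variation. -/
theorem varDeriv_eq_of_intg_evol {f : Fld} {Y : Fin 3 → Fld}
    (h : ∀ X, intg (evol X f) = intg (∑ α, X α * Y α)) : varDeriv f = Y := by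
  funext α
  refine sub_eq_zero.mp (eq_zero_of_forall_intg_mul fun g => ?_)
  -- A variation of one component alone isolates the α-th entry, with an arbitrary test function
  -- `g`.
  have hg := h (Pi.single α g)
  have key : ∀ Z : Fin 3 → Fld, ∑ β, (Pi.single α g : Fin 3 → Fld) β * Z β = g * Z α := by
    intro Z
    rw [Finset.sum_eq_single α]
    · rw [Pi.single_eq_same]
    · intro β _ hb
      rw [Pi.single_eq_of_ne hb, zero_mul]
    · simp
  rw [intg_evol, key, key] at hg
  rw [mul_sub, map_sub, hg, sub_self]

/-! ### The operator `𝒫₁` is Hamiltonian -/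

theorem P1_app_zero (Y : Fin 3 → Fld) : P1.app Y 0 =
    shift 1 (Y 0) - shift (-1) (Y 0) + (w * shift (-1) (Y 1) - shift 2 (w * Y 1)) := by
  simp [OpMatrix.app, P1, Fin.sum_univ_three, mulOp]

theorem P1_app_one (Y : Fin 3 → Fld) : P1.app Y 1 =
    w * shift (-2) (Y 0) - shift 1 (w * Y 0) + (w * shift (-1) (u * Y 1) - u * shift 1 (w * Y 1)) +
      (shift 1 (w * Y 2) - w * Y 2) := by
  simp [OpMatrix.app, P1, Fin.sum_univ_three, mulOp]

theorem P1_app_two (Y : Fin 3 → Fld) : P1.app Y 2 = w * (Y 1 - shift (-1) (Y 1)) := by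
  simp [OpMatrix.app, P1, Fin.sum_univ_three, mulOp]

theorem intg_sub_shift (n : ℤ) (f : Fld) : intg (f - shift n f) = 0 := by
  rw [map_sub, intg_shift, sub_self]

theorem intg_P1_skew (X Y : Fin 3 → Fld) :
    intg (∑ α, (X α * P1.app Y α + Y α * P1.app X α)) = 0 := by
  -- Each difference pairs a term of an entry of 𝒫₁ with the adjoint term that cancels it under the
  -- integral.
  have h : ∑ α, (X α * P1.app Y α + Y α * P1.app X α) =
      (Y 0 * shift 1 (X 0) - shift (-1) (Y 0 * shift 1 (X 0))) +
      (X 0 * shift 1 (Y 0) - shift (-1) (X 0 * shift 1 (Y 0))) +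
      (Y 1 * (w * shift (-2) (X 0)) - shift 2 (Y 1 * (w * shift (-2) (X 0)))) +
      (X 1 * (w * shift (-2) (Y 0)) - shift 2 (X 1 * (w * shift (-2) (Y 0)))) +
      (X 0 * (w * shift (-1) (Y 1)) - shift 1 (X 0 * (w * shift (-1) (Y 1)))) +
      (Y 0 * (w * shift (-1) (X 1)) - shift 1 (Y 0 * (w * shift (-1) (X 1)))) +
      (X 1 * (w * shift (-1) (u * Y 1)) - shift 1 (X 1 * (w * shift (-1) (u * Y 1)))) +
      (Y 1 * (w * shift (-1) (u * X 1)) - shift 1 (Y 1 * (w * shift (-1) (u * X 1)))) +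
      (X 1 * shift 1 (w * Y 2) - shift (-1) (X 1 * shift 1 (w * Y 2))) +
      (Y 1 * shift 1 (w * X 2) - shift (-1) (Y 1 * shift 1 (w * X 2))) := by
    simp only [Fin.sum_univ_three, P1_app_zero, P1_app_one, P1_app_two, shift_mul, shift_shift]
    norm_num [shift_zero_apply]
    ring
  rw [h]
  simp only [map_add, intg_sub_shift, add_zero]

/-- The derivative of the coefficients of `𝒫₁` in the direction `X`, applied to `Y`. -/
def dP1 (X Y : Fin 3 → Fld) : Fin 3 → Fld :=
  ![X 2 * shift (-1) (Y 1) - shift 2 (X 2 * Y 1),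
    X 2 * shift (-2) (Y 0) - shift 1 (X 2 * Y 0) +
      (X 2 * shift (-1) (u * Y 1) + w * shift (-1) (X 0 * Y 1) - X 0 * shift 1 (w * Y 1) -
        u * shift 1 (X 2 * Y 1)) + (shift 1 (X 2 * Y 2) - X 2 * Y 2),
    X 2 * (Y 1 - shift (-1) (Y 1))]

theorem evol_P1_app (X Y : Fin 3 → Fld) (α : Fin 3) :
    evol X (P1.app Y α) = P1.app (fun β => evol X (Y β)) α + dP1 X Y α := by
  fin_cases α
  · simp [P1_app_zero, dP1, evol_add, evol_sub, evol_shift, evol_mul, evol_w, shift_mul]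
    ring
  · simp [P1_app_one, dP1, evol_add, evol_sub, evol_shift, evol_mul, evol_w, evol_u, shift_mul]
    ring
  · simp [P1_app_two, dP1, evol_sub, evol_shift, evol_mul, evol_w]
    ring

/-- A representative of `∫ ∑ a_α (D_{𝒫₁ c} 𝒫₁ b)_α dx` in which the least shift in every monomial is
zero. -/
def schoutenDensity (a b c : Fin 3 → Fld) : Fld :=
  shift 1 (a 0) * b 1 * shift 1 (c 1) * shift 1 w - shift 1 (a 0) * b 1 * c 1 * shift 1 w -
  a 0 * shift 2 (b 1) * shift 2 (c 1) * shift 2 w +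
  a 0 * shift 2 (b 1) * shift 1 (c 1) * shift 2 w +
  shift 2 (a 1) * b 0 * shift 2 (c 1) * shift 2 w -
  shift 2 (a 1) * b 0 * shift 1 (c 1) * shift 2 w -
  a 1 * shift 1 (b 0) * shift 1 (c 1) * shift 1 w + a 1 * shift 1 (b 0) * c 1 * shift 1 w +
  shift 1 (a 1) * b 1 * shift 1 (c 1) * u * shift 1 w -
  shift 1 (a 1) * b 1 * c 1 * u * shift 1 w + shift 1 (a 1) * b 1 * shift 1 (c 0) * shift 1 w -
  shift 2 (a 1) * shift 1 (b 1) * c 0 * shift 2 w +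
  shift 2 (a 1) * shift 1 (b 1) * c 1 * shift 1 w * shift 2 w -
  shift 1 (a 1) * b 1 * shift 2 (c 1) * shift 1 w * shift 2 w -
  a 1 * shift 1 (b 1) * shift 1 (c 0) * shift 1 w +
  shift 1 (a 1) * shift 2 (b 1) * c 0 * shift 2 w -
  shift 1 (a 1) * shift 2 (b 1) * c 1 * shift 1 w * shift 2 w +
  a 1 * shift 1 (b 1) * shift 2 (c 1) * shift 1 w * shift 2 w -
  a 1 * shift 1 (b 1) * shift 1 (c 1) * u * shift 1 w +
  a 1 * shift 1 (b 1) * c 1 * u * shift 1 w + a 1 * shift 1 (b 2) * shift 1 (c 1) * shift 1 w -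
  a 1 * shift 1 (b 2) * c 1 * shift 1 w - a 1 * b 2 * c 1 * w +
  shift 1 (a 1) * shift 1 (b 2) * c 1 * shift 1 w + a 2 * b 1 * c 1 * w -
  shift 1 (a 2) * b 1 * shift 1 (c 1) * shift 1 w -
  shift 1 (a 2) * shift 1 (b 1) * c 1 * shift 1 w + shift 1 (a 2) * b 1 * c 1 * shift 1 w

theorem intg_dP1 (a b c : Fin 3 → Fld) :
    intg (∑ α, a α * dP1 (P1.app c) b α) = intg (schoutenDensity a b c) := by
  -- `e₁` and `e₂` collect the monomials whose least shift is -1 and -2; applying Λ and Λ² brings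
  -- them to the normal form of `schoutenDensity`.
  obtain ⟨e₁, h₁⟩ : ∃ e, e =
      a 0 * shift (-1) (b 1) * c 1 * w - a 0 * shift (-1) (b 1) * shift (-1) (c 1) * w +
      a 1 * shift (-1) (b 1) * c 1 * shift (-1) u * w -
      a 1 * shift (-1) (b 1) * shift (-1) (c 1) * shift (-1) u * w +
      a 1 * shift (-1) (b 1) * c 0 * w -
      a 1 * shift (-1) (b 1) * shift 1 (c 1) * w * shift 1 w +
      a 1 * shift 1 (b 1) * shift (-1) (c 0) * shift 1 w -
      a 1 * shift 1 (b 1) * shift (-1) (c 1) * w * shift 1 w +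
      a 1 * b 2 * shift (-1) (c 1) * w - a 2 * shift (-1) (b 1) * c 1 * w -
      a 2 * b 1 * shift (-1) (c 1) * w + a 2 * shift (-1) (b 1) * shift (-1) (c 1) * w := ⟨_, rfl⟩
  obtain ⟨e₂, h₂⟩ : ∃ e, e =
      a 1 * shift (-2) (b 0) * c 1 * w - a 1 * shift (-2) (b 0) * shift (-1) (c 1) * w -
      a 1 * shift (-1) (b 1) * shift (-2) (c 0) * w +
      a 1 * shift (-1) (b 1) * shift (-2) (c 1) * shift (-1) w * w := ⟨_, rfl⟩
  have h : ∑ α, a α * dP1 (P1.app c) b α =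
      schoutenDensity a b c + (e₁ - shift 1 e₁) + (e₂ - shift 2 e₂) := by
    simp only [h₁, h₂, schoutenDensity, Fin.sum_univ_three, dP1, P1_app_zero, P1_app_two,
      Matrix.cons_val_zero, Matrix.cons_val_one, Matrix.cons_val, map_add, map_sub, shift_mul,
      shift_shift]
    norm_num [shift_zero_apply]
    ring
  rw [h, map_add, map_add, intg_sub_shift, intg_sub_shift, add_zero, add_zero]

/-- The Schouten identity for 𝒫₁. In normal form the cyclic sum cancels as a polynomial, with no
further integration by parts. -/
theorem intg_dP1_cyclic (a b c : Fin 3 → Fld) :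
    intg (∑ α, a α * dP1 (P1.app c) b α) + intg (∑ α, b α * dP1 (P1.app a) c α) +
      intg (∑ α, c α * dP1 (P1.app b) a α) = 0 := by
  have h : schoutenDensity a b c + schoutenDensity b c a + schoutenDensity c a b = 0 := by
    simp only [schoutenDensity]
    ring
  rw [intg_dP1, intg_dP1, intg_dP1, ← map_add, ← map_add, h, map_zero]

/-- The second variation of a local functional is symmetric. -/
theorem intg_hessian_symm (f : Fld) (X Y : Fin 3 → Fld) :
    intg (∑ α, Y α * evol X (varDeriv f α)) = intg (∑ α, X α * evol Y (varDeriv f α)) := by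
  have key : ∀ X Y : Fin 3 → Fld, intg (evol X (evol Y f)) =
      intg (∑ α, Y α * evol X (varDeriv f α)) + intg (∑ α, evol X (Y α) * varDeriv f α) := by
    intro X Y
    rw [intg_evol_of_intg_eq X (intg_evol Y f), evol_sum, ← map_add, ← Finset.sum_add_distrib]
    refine congrArg intg (Finset.sum_congr rfl fun α _ => ?_)
    rw [evol_mul]
    ring
  -- The antisymmetric part of the iterated derivative is a first variation along the commutator
  -- field, which accounts exactly for the terms where `X` or `Y` is differentiated.
  have h := congrArg intg (evol_commutator X Y f)
  rw [map_sub, key, key, intg_evol] at h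
  simp only [sub_mul, Finset.sum_sub_distrib, map_sub] at h
  rwa [add_sub_add_comm, add_eq_right, sub_eq_zero] at h

/-- The outer bracket differentiates the inner one along the field of `h`. The three terms come from
differentiating δf, δg and the coefficients of 𝒫₁; skew-adjointness moves 𝒫₁ off the varied δg. -/
theorem intg_bracket_bracket (f g h : Fld) :
    intg (bracket P1 (bracket P1 f g) h) =
      intg (∑ α, P1.app (varDeriv g) α * evol (P1.app (varDeriv h)) (varDeriv f α)) -
      intg (∑ α, P1.app (varDeriv f) α * evol (P1.app (varDeriv h)) (varDeriv g α)) +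
      intg (∑ α, varDeriv f α * dP1 (P1.app (varDeriv h)) (varDeriv g) α) := by
  have h1 : intg (bracket P1 (bracket P1 f g) h) =
      intg (evol (P1.app (varDeriv h)) (bracket P1 f g)) := by
    rw [intg_evol, bracket]
    exact congrArg intg (Finset.sum_congr rfl fun α _ => mul_comm _ _)
  have h2 := intg_P1_skew (varDeriv f) fun β => evol (P1.app (varDeriv h)) (varDeriv g β)
  rw [Finset.sum_add_distrib, map_add] at h2
  have h3 : evol (P1.app (varDeriv h)) (bracket P1 f g) =
      (∑ α, P1.app (varDeriv g) α * evol (P1.app (varDeriv h)) (varDeriv f α)) +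
      (∑ α, varDeriv f α * P1.app (fun β => evol (P1.app (varDeriv h)) (varDeriv g β)) α) +
      ∑ α, varDeriv f α * dP1 (P1.app (varDeriv h)) (varDeriv g) α := by
    rw [bracket, evol_sum, ← Finset.sum_add_distrib, ← Finset.sum_add_distrib]
    refine Finset.sum_congr rfl fun α _ => ?_
    rw [evol_mul, evol_P1_app]
    ring
  have h4 : ∑ α, evol (P1.app (varDeriv h)) (varDeriv g α) * P1.app (varDeriv f) α =
      ∑ α, P1.app (varDeriv f) α * evol (P1.app (varDeriv h)) (varDeriv g α) :=
    Finset.sum_congr rfl fun α _ => mul_comm _ _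
  rw [h4] at h2
  rw [h1, h3, map_add, map_add, eq_neg_of_add_eq_zero_left h2, ← sub_eq_add_neg]

theorem isHamiltonian_P1 : IsHamiltonian P1 where
  skew X Y := intg_eq_zero.mp (intg_P1_skew X Y)
  jacobi f g h := by
    rw [← intg_eq_zero, map_add, map_add, intg_bracket_bracket, intg_bracket_bracket,
      intg_bracket_bracket]
    have hc := intg_dP1_cyclic (varDeriv f) (varDeriv g) (varDeriv h)
    -- Each second variation occurs twice with opposite signs and exchanged arguments; symmetry
    -- makes the two occurrences equal.
    rw [intg_hessian_symm f, intg_hessian_symm g, intg_hessian_symm h]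
    rw [← hc]
    abel

/-! ### The rings of difference operators of bounded order -/

/-- The difference operators whose order is bounded above, for `σ = 1`, or below, for `σ = -1`. -/
def boundedOps (σ : ℤˣ) : AddSubgroup Op where
  carrier := {X | ∃ N : ℕ, ∀ n : ℤ, (N : ℤ) < σ * n → X n = 0}
  add_mem' := by
    rintro X Y ⟨a, ha⟩ ⟨b, hb⟩
    refine ⟨a + b, fun n hn => ?_⟩
    push_cast at hn
    change X n + Y n = 0
    rw [ha n (by omega), hb n (by omega), add_zero]
  zero_mem' := ⟨0, fun _ _ => rfl⟩
  neg_mem' := by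
    rintro X ⟨a, ha⟩
    refine ⟨a, fun n hn => ?_⟩
    change -X n = 0
    rw [ha n hn, neg_zero]

namespace Op

/-- One symmetric interval serves both directions of boundedness, and any larger one too, so that
several products can be expanded over a common index set. -/
theorem mul_apply_Icc {σ : ℤˣ} {X Y : Op} {a b : ℕ} (hX : ∀ n : ℤ, (a : ℤ) < σ * n → X n = 0)
    (hY : ∀ n : ℤ, (b : ℤ) < σ * n → Y n = 0) {n K : ℤ} (hK : a + b + |n| ≤ K) :
    (X * Y) n = ∑ i ∈ Finset.Icc (-K) K, X i * shift i (Y (n - i)) := by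
  refine mul_apply_sum _ _ _ _ fun i hi => ?_
  have h1 := le_abs_self n
  have h2 := neg_abs_le n
  rw [Finset.mem_Icc, not_and_or, not_le, not_le] at hi
  rcases Int.units_eq_one_or σ with rfl | rfl
  · rcases hi with hi | hi
    · exact Or.inr (hY _ (by push_cast; omega))
    · exact Or.inl (hX _ (by push_cast; omega))
  · rcases hi with hi | hi
    · exact Or.inl (hX _ (by push_cast; omega))
    · exact Or.inr (hY _ (by push_cast; omega))

theorem mul_bounded {σ : ℤˣ} {X Y : Op} {a b : ℕ} (hX : ∀ n : ℤ, (a : ℤ) < σ * n → X n = 0)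
    (hY : ∀ n : ℤ, (b : ℤ) < σ * n → Y n = 0) (n : ℤ) (hn : ((a + b : ℕ) : ℤ) < σ * n) :
    (X * Y) n = 0 := by
  rw [mul_apply_sum _ _ _ ∅, Finset.sum_empty]
  intro i _
  by_cases h : (a : ℤ) < σ * i
  · exact Or.inl (hX i h)
  · refine Or.inr (hY _ ?_)
    rw [mul_sub]
    push_cast at hn
    omega

theorem mul_assoc_of_bounded {σ : ℤˣ} {X Y Z : Op} {a b c : ℕ}
    (hX : ∀ n : ℤ, (a : ℤ) < σ * n → X n = 0) (hY : ∀ n : ℤ, (b : ℤ) < σ * n → Y n = 0)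
    (hZ : ∀ n : ℤ, (c : ℤ) < σ * n → Z n = 0) : X * Y * Z = X * (Y * Z) := by
  funext n
  obtain ⟨K, hK⟩ : ∃ K : ℤ, a + b + c + |n| = K := ⟨_, rfl⟩
  have h1 := le_abs_self n
  have h2 := neg_abs_le n
  rw [mul_apply_Icc (mul_bounded hX hY) hZ (K := K) (by push_cast; omega),
    mul_apply_Icc hX (mul_bounded hY hZ) (K := K) (by push_cast; omega)]
  have hL : ∀ i, (X * Y) i * shift i (Z (n - i)) = ∑ j ∈ Finset.Icc (-K) K,
      X j * shift j (Y (i - j)) * shift i (Z (n - i)) := by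
    intro i
    -- For general i the interval may be too short to expand (X * Y) i; a nonzero factor `Z (n - i)`
    -- bounds i and makes it long enough.
    by_cases hz : Z (n - i) = 0
    · simp [hz]
    have hi : (σ : ℤ) * (n - i) ≤ c := by
      by_contra h
      exact hz (hZ _ (by omega))
    rw [← Finset.sum_mul, mul_apply_sum _ _ _ (Finset.Icc (-K) K)]
    intro j hj
    rw [Finset.mem_Icc, not_and_or, not_le, not_le] at hj
    rcases Int.units_eq_one_or σ with rfl | rfl
    · push_cast at hi
      rcases hj with hj | hj
      · exact Or.inr (hY _ (by push_cast; omega))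
      · exact Or.inl (hX _ (by push_cast; omega))
    · push_cast at hi
      rcases hj with hj | hj
      · exact Or.inl (hX _ (by push_cast; omega))
      · exact Or.inr (hY _ (by push_cast; omega))
  have hR : ∀ j, X j * shift j ((Y * Z) (n - j)) = ∑ i ∈ Finset.Icc (-K) K,
      X j * shift j (Y (i - j)) * shift i (Z (n - i)) := by
    intro j
    by_cases hx : X j = 0
    · simp [hx]
    have hj : (σ : ℤ) * j ≤ a := by
      by_contra h
      exact hx (hX _ (by omega))
    have hs : (Y * Z) (n - j) = ∑ i ∈ Finset.Icc (-K) K,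
        Y (i - j) * shift (i - j) (Z (n - i)) := by
      rw [mul_apply, ← finsum_comp_equiv (Equiv.subRight j)]
      simp only [Equiv.subRight_apply, sub_sub_sub_cancel_right]
      refine finsum_eq_sum_of_support_subset _ fun i hi => ?_
      by_contra hs
      rw [Finset.mem_coe, Finset.mem_Icc, not_and_or, not_le, not_le] at hs
      have : Y (i - j) = 0 ∨ Z (n - i) = 0 := by
        rcases Int.units_eq_one_or σ with rfl | rfl
        · push_cast at hj
          rcases hs with hs | hs
          · exact Or.inr (hZ _ (by push_cast; omega))
          · exact Or.inl (hY _ (by push_cast; omega))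
        · push_cast at hj
          rcases hs with hs | hs
          · exact Or.inl (hY _ (by push_cast; omega))
          · exact Or.inr (hZ _ (by push_cast; omega))
      rcases this with h | h <;> simp [h] at hi
    rw [hs, map_sum, Finset.mul_sum]
    refine Finset.sum_congr rfl fun i _ => ?_
    rw [shift_mul, shift_shift, add_sub_cancel, mul_assoc]
  simp only [hL, hR]
  exact Finset.sum_comm

theorem add_apply (X Y : Op) (n : ℤ) : (X + Y) n = X n + Y n := rfl

theorem sub_apply (X Y : Op) (n : ℤ) : (X - Y) n = X n - Y n := rfl

theorem one_apply (n : ℤ) : (1 : Op) n = if n = 0 then 1 else 0 := rfl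

theorem one_mul' (X : Op) : 1 * X = X := by
  funext n
  rw [mul_apply_sum _ _ _ {0} fun i hi => Or.inl (by
    rw [one_apply, if_neg (by simpa using hi)])]
  simp [one_apply, shift_zero_apply]

theorem mul_one' (X : Op) : X * 1 = X := by
  funext n
  rw [mul_apply_sum _ _ _ {n} fun i hi => Or.inr (by
    rw [one_apply, if_neg (by rw [Finset.mem_singleton] at hi; omega)])]
  simp [one_apply, shift_one]

theorem mul_add_of_bounded {σ : ℤˣ} {X Y Z : Op} {a b c : ℕ}
    (hX : ∀ n : ℤ, (a : ℤ) < σ * n → X n = 0) (hY : ∀ n : ℤ, (b : ℤ) < σ * n → Y n = 0)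
    (hZ : ∀ n : ℤ, (c : ℤ) < σ * n → Z n = 0) : X * (Y + Z) = X * Y + X * Z := by
  funext n
  have hYZ : ∀ n : ℤ, ((b + c : ℕ) : ℤ) < σ * n → (Y + Z) n = 0 := fun n hn => by
    push_cast at hn
    rw [add_apply, hY n (by omega), hZ n (by omega), add_zero]
  rw [add_apply, mul_apply_Icc hX hYZ (K := a + b + c + |n|) (by push_cast; omega),
    mul_apply_Icc hX hY (K := a + b + c + |n|) (by omega),
    mul_apply_Icc hX hZ (K := a + b + c + |n|) (by omega), ← Finset.sum_add_distrib]
  refine Finset.sum_congr rfl fun i _ => ?_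
  rw [add_apply, map_add, mul_add]

theorem add_mul_of_bounded {σ : ℤˣ} {X Y Z : Op} {a b c : ℕ}
    (hX : ∀ n : ℤ, (a : ℤ) < σ * n → X n = 0) (hY : ∀ n : ℤ, (b : ℤ) < σ * n → Y n = 0)
    (hZ : ∀ n : ℤ, (c : ℤ) < σ * n → Z n = 0) : (X + Y) * Z = X * Z + Y * Z := by
  funext n
  have hXY : ∀ n : ℤ, ((a + b : ℕ) : ℤ) < σ * n → (X + Y) n = 0 := fun n hn => by
    push_cast at hn
    rw [add_apply, hX n (by omega), hY n (by omega), add_zero]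
  rw [add_apply, mul_apply_Icc hXY hZ (K := a + b + c + |n|) (by push_cast; omega),
    mul_apply_Icc hX hZ (K := a + b + c + |n|) (by omega),
    mul_apply_Icc hY hZ (K := a + b + c + |n|) (by omega), ← Finset.sum_add_distrib]
  refine Finset.sum_congr rfl fun i _ => ?_
  rw [add_apply, add_mul]

theorem zero_mul' (X : Op) : 0 * X = 0 := by
  funext n
  rw [mul_apply_sum 0 X n ∅ fun i _ => Or.inl rfl]
  rfl

theorem mul_zero' (X : Op) : X * 0 = 0 := by
  funext n
  rw [mul_apply_sum X 0 n ∅ fun i _ => Or.inr rfl]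
  rfl

end Op

/-- The ring of difference operators of order bounded above (`σ = 1`) or below (`σ = -1`). -/
def BOp (σ : ℤˣ) : Type := boundedOps σ

namespace BOp

variable {σ : ℤˣ}

instance : AddCommGroup (BOp σ) := inferInstanceAs (AddCommGroup (boundedOps σ))

instance : One (BOp σ) := ⟨⟨1, 0, fun n hn => by
  rw [Op.one_apply, if_neg]
  rintro rfl
  simp at hn⟩⟩

instance : Mul (BOp σ) := ⟨fun X Y => ⟨X.1 * Y.1, by
  obtain ⟨a, ha⟩ := X.2
  obtain ⟨b, hb⟩ := Y.2
  exact ⟨a + b, Op.mul_bounded ha hb⟩⟩⟩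

theorem coe_mul (X Y : BOp σ) : (X * Y).1 = X.1 * Y.1 := rfl

theorem coe_add (X Y : BOp σ) : (X + Y).1 = X.1 + Y.1 := rfl

theorem coe_sub (X Y : BOp σ) : (X - Y).1 = X.1 - Y.1 := rfl

instance : Ring (BOp σ) where
  __ := (inferInstance : AddCommGroup (BOp σ))
  mul_assoc X Y Z := by
    obtain ⟨a, ha⟩ := X.2
    obtain ⟨b, hb⟩ := Y.2
    obtain ⟨c, hc⟩ := Z.2
    exact Subtype.ext (Op.mul_assoc_of_bounded ha hb hc)
  one_mul X := Subtype.ext (Op.one_mul' X.1)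
  mul_one X := Subtype.ext (Op.mul_one' X.1)
  zero_mul X := Subtype.ext (Op.zero_mul' X.1)
  mul_zero X := Subtype.ext (Op.mul_zero' X.1)
  left_distrib X Y Z := by
    obtain ⟨a, ha⟩ := X.2
    obtain ⟨b, hb⟩ := Y.2
    obtain ⟨c, hc⟩ := Z.2
    exact Subtype.ext (Op.mul_add_of_bounded ha hb hc)
  right_distrib X Y Z := by
    obtain ⟨a, ha⟩ := X.2
    obtain ⟨b, hb⟩ := Y.2
    obtain ⟨c, hc⟩ := Z.2
    exact Subtype.ext (Op.add_mul_of_bounded ha hb hc)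

theorem coe_pow (X : BOp σ) (n : ℕ) : (X ^ n).1 = X.1 ^ n := by
  induction n with
  | zero => rfl
  | succ n ih =>
    rw [pow_succ, coe_mul, ih]
    rfl

/-- The functional `X ↦ ∫ Res X dx`. -/
def tr : BOp σ →+ Fld ⧸ LinearMap.range dX :=
  AddMonoidHom.mk' (fun X => intg (X.1 0)) fun X Y => by
    rw [coe_add, Op.add_apply, map_add]

theorem tr_apply (X : BOp σ) : tr X = intg (X.1 0) := rfl

/-- Applying Λ^{-i} to X_i Λ^i(Y_{-i}) gives the term of index -i in Res(YX), and the integral does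
not see the shift. -/
theorem tr_mul_comm (X Y : BOp σ) : tr (X * Y) = tr (Y * X) := by
  obtain ⟨a, ha⟩ := X.2
  obtain ⟨b, hb⟩ := Y.2
  rw [tr_apply, tr_apply, coe_mul, coe_mul, Op.mul_apply_Icc ha hb (K := a + b) (by simp),
    Op.mul_apply_Icc hb ha (K := a + b) (by simp; omega), map_sum, map_sum]
  refine Finset.sum_equiv (Equiv.neg ℤ) (fun i => ?_) fun i _ => ?_
  · simp only [Equiv.neg_apply, Finset.mem_Icc]
    omega
  · rw [← intg_shift (-i), shift_mul, shift_shift, Equiv.neg_apply]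
    simp only [neg_add_cancel, shift_zero_apply, zero_sub, neg_neg, mul_comm]

/-- The derivative of an operator along an evolutionary vector field. -/
def der (ξ : Fin 3 → Fld) : BOp σ →+ BOp σ :=
  AddMonoidHom.mk' (fun X => ⟨Op.evol ξ X.1, by
    obtain ⟨a, ha⟩ := X.2
    exact ⟨a, fun n hn => by rw [Op.evol, ha n hn, evol_zero]⟩⟩)
    fun X Y => Subtype.ext (funext fun n => evol_add ξ (X.1 n) (Y.1 n))

theorem der_apply (ξ : Fin 3 → Fld) (X : BOp σ) (n : ℤ) : (der ξ X).1 n = evol ξ (X.1 n) := rfl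

theorem der_mul (ξ : Fin 3 → Fld) (X Y : BOp σ) :
    der ξ (X * Y) = der ξ X * Y + X * der ξ Y := by
  refine Subtype.ext (funext fun n => ?_)
  obtain ⟨a, ha⟩ := X.2
  obtain ⟨b, hb⟩ := Y.2
  have ha' : ∀ n : ℤ, (a : ℤ) < σ * n → (der ξ X).1 n = 0 := fun n hn => by
    rw [der_apply, ha n hn, evol_zero]
  have hb' : ∀ n : ℤ, (b : ℤ) < σ * n → (der ξ Y).1 n = 0 := fun n hn => by
    rw [der_apply, hb n hn, evol_zero]
  rw [der_apply, coe_add, coe_mul, coe_mul, coe_mul, Op.add_apply, Op.mul_apply_Icc ha hb le_rfl,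
    Op.mul_apply_Icc ha' hb le_rfl, Op.mul_apply_Icc ha hb' le_rfl, evol_sum,
    ← Finset.sum_add_distrib]
  refine Finset.sum_congr rfl fun i _ => ?_
  rw [evol_mul, evol_shift, der_apply, der_apply]
  ring

/-- The power rule holds only under the trace. The extra factor `X ^ m` absorbs the powers that the
induction moves to the right. -/
theorem tr_der_pow_mul (ξ : Fin 3 → Fld) (X : BOp σ) (n m : ℕ) :
    tr (der ξ (X ^ (n + 1)) * X ^ m) = (n + 1) • tr (X ^ (n + m) * der ξ X) := by
  induction n generalizing m with
  | zero => rw [zero_add, zero_add, pow_one, one_smul, tr_mul_comm]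
  | succ n ih =>
    rw [pow_succ X (n + 1), der_mul, add_mul, map_add, mul_assoc, ← pow_succ', ih, mul_assoc,
      tr_mul_comm (X ^ (n + 1)), mul_assoc, tr_mul_comm (der ξ X), ← pow_add]
    rw [show n + (m + 1) = m + (n + 1) by ring, show n + 1 + m = m + (n + 1) by ring,
      succ_nsmul _ (n + 1)]

theorem tr_der_pow (ξ : Fin 3 → Fld) (X : BOp σ) (n : ℕ) :
    tr (der ξ (X ^ (n + 1))) = (n + 1) • tr (X ^ n * der ξ X) := by
  simpa using tr_der_pow_mul ξ X n 0

theorem intg_evol_res_pow (ξ : Fin 3 → Fld) (X : BOp σ) (n : ℕ) :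
    intg (evol ξ ((X.1 ^ (n + 1)).res)) = (n + 1) • tr (X ^ n * der ξ X) := by
  rw [← tr_der_pow, tr_apply, der_apply, coe_pow, Op.res]

end BOp

/-! ### Products with `A` and `B` -/

theorem opA_apply (n : ℤ) : opA n =
    (if n = 2 then 1 else 0) + (if n = 1 then u else 0) + (if n = 0 then v else 0) := rfl

theorem opB_apply (n : ℤ) : opB n = (if n = 0 then 1 else 0) - (if n = -1 then w else 0) := rfl

theorem opA_mul_apply (X : Op) (n : ℤ) :
    (opA * X) n = shift 2 (X (n - 2)) + u * shift 1 (X (n - 1)) + v * X n := by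
  rw [Op.mul_apply_sum _ _ _ {0, 1, 2} fun i hi => Or.inl (by
    simp only [Finset.mem_insert, Finset.mem_singleton, not_or] at hi
    simp [opA_apply, hi])]
  simp only [opA_apply]
  norm_num
  rw [shift_zero_apply]
  ring

theorem mul_opA_apply (X : Op) (n : ℤ) :
    (X * opA) n = X (n - 2) + X (n - 1) * shift (n - 1) u + X n * shift n v := by
  rw [Op.mul_apply_sum _ _ _ {n - 2, n - 1, n} fun i hi => Or.inr (by
    simp only [Finset.mem_insert, Finset.mem_singleton, not_or] at hi
    rw [opA_apply, if_neg (by omega), if_neg (by omega), if_neg (by omega)]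
    simp)]
  rw [Finset.sum_insert (by simp), Finset.sum_insert (by simp), Finset.sum_singleton]
  simp only [opA_apply]
  norm_num [shift_one]
  ring

theorem opB_mul_apply (X : Op) (n : ℤ) :
    (opB * X) n = X n - w * shift (-1) (X (n + 1)) := by
  rw [Op.mul_apply_sum _ _ _ {0, -1} fun i hi => Or.inl (by
    simp only [Finset.mem_insert, Finset.mem_singleton, not_or] at hi
    simp [opB_apply, hi])]
  simp only [opB_apply]
  norm_num
  rw [shift_zero_apply]
  ring

theorem mul_opB_apply (X : Op) (n : ℤ) :
    (X * opB) n = X n - X (n + 1) * shift (n + 1) w := by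
  rw [Op.mul_apply_sum _ _ _ {n, n + 1} fun i hi => Or.inr (by
    simp only [Finset.mem_insert, Finset.mem_singleton, not_or] at hi
    rw [opB_apply, if_neg (by omega), if_neg (by omega), sub_zero])]
  rw [Finset.sum_insert (by simp), Finset.sum_singleton]
  simp only [opB_apply]
  norm_num [shift_one]
  ring

theorem Op.ext_iff {X Y : Op} : X = Y ↔ ∀ n, X n = Y n := funext_iff

/-! ### From Lax equations to Hamiltonian equations -/

/-- ∂_t A lives in orders 1 and 0, and ∂_t B in order -1. The hypotheses say that the right-hand
sides are supported there too, so the Lax equations are consistent. -/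
theorem laxPair_iff (c : ℝ) (Yt Y : Op) (X : Fin 3 → Fld)
    (hA : ∀ n, n ≠ 0 → n ≠ 1 → (Yt * opA) n - (opA * Y) n = 0)
    (hB : ∀ n, n ≠ -1 → (Yt * opB) n - (opB * Y) n = 0) :
    LaxPair c Yt Y X ↔
      eps * X 0 = c • ((Yt * opA) 1 - (opA * Y) 1) ∧ eps * X 1 = c • ((Yt * opA) 0 - (opA * Y) 0) ∧
        eps * X 2 = -(c • ((Yt * opB) (-1) - (opB * Y) (-1))) := by
  have h1 : ∀ n, (eps • Op.evol X opA) n =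
      eps * ((if n = 1 then X 0 else 0) + if n = 0 then X 1 else 0) := fun n => by
    change eps * evol X (opA n) = _
    rw [opA_apply, evol_add, evol_add]
    split_ifs <;> simp [evol_one, evol_zero, evol_u, evol_v]
  have h2 : ∀ n, (eps • Op.evol X opB) n = eps * -(if n = -1 then X 2 else 0) := fun n => by
    change eps * evol X (opB n) = _
    rw [opB_apply, evol_sub]
    split_ifs <;> simp [evol_one, evol_zero, evol_w]
  have h3 : ∀ (Z W : Op) (n : ℤ), (c • (Z - W)) n = c • (Z n - W n) := fun _ _ _ => rfl
  rw [LaxPair, Op.ext_iff, Op.ext_iff]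
  simp only [h1, h2, h3]
  constructor
  · rintro ⟨ha, hb⟩
    refine ⟨?_, ?_, ?_⟩
    · simpa using ha 1
    · simpa using ha 0
    · rw [← hb (-1)]
      simp
  · rintro ⟨h0, h1, h2⟩
    refine ⟨fun n => ?_, fun n => ?_⟩
    · by_cases hn : n = 0
      · subst hn
        simpa using h1
      by_cases hn' : n = 1
      · subst hn'
        simpa using h0
      rw [hA n hn hn', if_neg hn, if_neg hn']
      simp
    · by_cases hn : n = -1
      · subst hn
        rw [if_pos rfl, mul_neg, h2, neg_neg]
      rw [hB n hn, if_neg hn]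
      simp

theorem P1_app_smul (c : ℝ) (Y : Fin 3 → Fld) (α : Fin 3) :
    P1.app (c • Y) α = c • P1.app Y α := by
  simp only [OpMatrix.app, Pi.smul_apply, map_smul, Finset.smul_sum]

/-- Verified on coefficients because `Q` is not assumed to be of bounded order. -/
theorem opB_mul_mul_opB (Q : Op) (n : ℤ) : (opB * Q * opB) n = (opB * (Q * opB)) n := by
  simp only [opB_mul_apply, mul_opB_apply, map_sub, shift_mul, shift_shift]
  rw [show -1 + (n + 1 + 1) = n + 1 by ring]
  ring

/-- The equations `ε ∂_t Z = c ((B Q)_+ Z - Z (Q B)_+)` for `Z = A, B` in Hamiltonian form. -/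
theorem laxPair_pos_iff (c : ℝ) (Q : Op) (ρ : Fld) (X : Fin 3 → Fld)
    (hA : opB * Q * opA = opA * (Q * opB))
    (hρ : shift 1 (w * ρ) - w * ρ = (opA * Q) 0 - (Q * opA) 0) :
    LaxPair c (opB * Q).pos (Q * opB).pos X ↔
      (fun α => eps * X α) = P1.app (c • ![shift 1 (Q (-1)), Q 0, ρ]) := by
  have hA' : ∀ n, (opB * Q * opA) n = (opA * (Q * opB)) n := fun n => by rw [hA]
  have hB' := opB_mul_mul_opB Q
  have hpos : ∀ (Z : Op) (n : ℤ), Z.pos n = if 0 ≤ n then Z n else 0 := fun _ _ => rfl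
  rw [laxPair_iff]
  · have e0 : ((opB * Q).pos * opA) 1 - (opA * (Q * opB).pos) 1 =
        P1.app ![shift 1 (Q (-1)), Q 0, ρ] 0 := by
      have h := hA' 1
      simp only [mul_opA_apply, opA_mul_apply, hpos, P1_app_zero] at h ⊢
      norm_num at h ⊢
      simp only [opB_mul_apply, mul_opB_apply, map_sub, shift_mul, shift_shift] at h ⊢
      norm_num [shift_zero_apply] at h ⊢
      linear_combination h
    -- Here the truncation also removes order -2; `hρ` trades the resulting Λ²Q_{-2} - Q_{-2} for ρ.
    have e1 : ((opB * Q).pos * opA) 0 - (opA * (Q * opB).pos) 0 =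
        P1.app ![shift 1 (Q (-1)), Q 0, ρ] 1 := by
      have h := hA' 0
      simp only [mul_opA_apply, opA_mul_apply, hpos, P1_app_one, Matrix.cons_val] at h hρ ⊢
      norm_num at h hρ ⊢
      simp only [opB_mul_apply, mul_opB_apply, map_sub, shift_mul, shift_shift] at h hρ ⊢
      norm_num [shift_zero_apply] at h hρ ⊢
      linear_combination h - hρ
    have e2 : -(((opB * Q).pos * opB) (-1) - (opB * (Q * opB).pos) (-1)) =
        P1.app ![shift 1 (Q (-1)), Q 0, ρ] 2 := by
      simp only [mul_opB_apply, opB_mul_apply, hpos, P1_app_two]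
      norm_num [shift_zero_apply]
      simp only [shift_mul, shift_shift]
      norm_num [shift_zero_apply]
      ring
    rw [e0, e1, ← smul_neg, e2, funext_iff, Fin.forall_fin_succ, Fin.forall_fin_two]
    simp only [P1_app_smul]
    rfl
  -- For n < 0 every truncated term vanishes; for n ≥ 2 all orders involved are nonnegative and
  -- nothing is truncated.
  · intro n h0 h1
    rcases lt_or_ge n 0 with hn | hn
    · simp only [mul_opA_apply, opA_mul_apply, hpos]
      simp [show ¬ 0 ≤ n by omega, show ¬ 1 ≤ n by omega, show ¬ 2 ≤ n by omega]
    · have h := hA' n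
      simp only [mul_opA_apply, opA_mul_apply, hpos] at h ⊢
      rw [if_pos (by omega), if_pos (by omega), if_pos (by omega), if_pos (by omega),
        if_pos (by omega), if_pos (by omega), h, sub_self]
  · intro n h0
    rcases lt_or_ge n 0 with hn | hn
    · simp only [mul_opB_apply, opB_mul_apply, hpos]
      simp [show ¬ 0 ≤ n by omega, show ¬ 0 ≤ n + 1 by omega]
    · have h := hB' n
      rw [mul_opB_apply, opB_mul_apply (Q * opB)] at h
      rw [mul_opB_apply, opB_mul_apply (Q * opB).pos]
      simp only [hpos]
      rw [if_pos (by omega), if_pos (by omega), if_pos (by omega), if_pos (by omega), h, sub_self]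

/-- (-Z)_- = Z_+ - Z, and the untruncated operators contribute nothing to either Lax equation. -/
theorem laxPair_neg_iff (c : ℝ) (Q : Op) (X : Fin 3 → Fld)
    (hA : opB * Q * opA = opA * (Q * opB)) :
    LaxPair c (-(opB * Q)).neg (-(Q * opB)).neg X ↔ LaxPair c (opB * Q).pos (Q * opB).pos X := by
  have hA' : ∀ n, (opB * Q * opA) n = (opA * (Q * opB)) n := fun n => by rw [hA]
  have hn : ∀ (Z : Op) (n : ℤ), (-Z).neg n = Z.pos n - Z n := fun Z n => by
    change (if n ≤ -1 then -Z n else 0) = (if 0 ≤ n then Z n else 0) - Z n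
    split_ifs <;> first | omega | simp
  have e1 : (-(opB * Q)).neg * opA - opA * (-(Q * opB)).neg =
      (opB * Q).pos * opA - opA * (Q * opB).pos := by
    funext n
    have h := hA' n
    simp only [Op.sub_apply, mul_opA_apply, opA_mul_apply, hn, map_sub] at h ⊢
    linear_combination -h
  have e2 : (-(opB * Q)).neg * opB - opB * (-(Q * opB)).neg =
      (opB * Q).pos * opB - opB * (Q * opB).pos := by
    funext n
    have h := opB_mul_mul_opB Q n
    rw [mul_opB_apply, opB_mul_apply (Q * opB)] at h
    rw [Op.sub_apply, Op.sub_apply, mul_opB_apply, opB_mul_apply, mul_opB_apply, opB_mul_apply]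
    simp only [hn, map_sub]
    linear_combination -h
  rw [LaxPair, LaxPair, e1, e2]

/-! ### The operators of the hierarchy as elements of the rings of bounded operators -/

/-- `A` as an operator of bounded order. -/
def bA (σ : ℤˣ) : BOp σ := ⟨opA, 2, fun n hn => by
  rcases Int.units_eq_one_or σ with rfl | rfl <;> push_cast at hn <;>
    rw [opA_apply, if_neg (by omega), if_neg (by omega), if_neg (by omega)] <;> simp⟩

/-- `B` as an operator of bounded order. -/
def bB (σ : ℤˣ) : BOp σ := ⟨opB, 1, fun n hn => by
  rcases Int.units_eq_one_or σ with rfl | rfl <;> push_cast at hn <;>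
    rw [opB_apply, if_neg (by omega), if_neg (by omega)] <;> simp⟩

/-- `B⁻¹` as an operator of order bounded above. -/
def bBInv : BOp 1 := ⟨opBInv, 0, fun n hn => by
  rw [opBInv, if_neg]
  push_cast at hn
  omega⟩

/-- `A⁻¹` as an operator of order bounded below. -/
def bAInv : BOp (-1) := ⟨opAInv, 0, fun n hn => by
  rw [opAInv, if_neg]
  push_cast at hn
  omega⟩

theorem bB_mul_bBInv : bB 1 * bBInv = 1 := Subtype.ext opB_mul_opBInv

theorem bA_mul_bAInv : bA (-1) * bAInv = 1 := Subtype.ext opA_mul_opAInv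

/-! ### Left cancellation of A and B, and two-sided inverses -/

theorem eq_zero_of_bB_mul {X : BOp 1} (h : bB 1 * X = 0) : X = 0 := by
  obtain ⟨N, hN⟩ := X.2
  have hc : ∀ n, X.1 n - w * shift (-1) (X.1 (n + 1)) = 0 := fun n => by
    rw [← opB_mul_apply]
    exact congrFun (congrArg Subtype.val h) n
  have hk : ∀ k : ℕ, X.1 (N + 1 - k) = 0 := fun k => by
    induction k with
    | zero => exact hN _ (by push_cast; omega)
    | succ k ih =>
      have := hc (N + 1 - (k + 1 : ℕ))
      rw [show (N : ℤ) + 1 - (k + 1 : ℕ) + 1 = N + 1 - k by push_cast; ring, ih] at this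
      simpa using this
  refine Subtype.ext (funext fun n => ?_)
  rcases lt_or_ge (N : ℤ) n with hn | hn
  · exact hN n (by push_cast; omega)
  · have := hk (N + 1 - n).toNat
    rwa [show (N : ℤ) + 1 - (N + 1 - n).toNat = n by omega] at this

theorem eq_zero_of_bA_mul {X : BOp (-1)} (h : bA (-1) * X = 0) : X = 0 := by
  obtain ⟨N, hN⟩ := X.2
  have hc : ∀ n, shift 2 (X.1 (n - 2)) + u * shift 1 (X.1 (n - 1)) + v * X.1 n = 0 := fun n => by
    rw [← opA_mul_apply]
    exact congrFun (congrArg Subtype.val h) n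
  -- The recursion from A has three terms and is solved upwards by dividing by v, so two consecutive
  -- zeros are carried along.
  have hk : ∀ k : ℕ, X.1 (k - 1 - N) = 0 ∧ X.1 (k - 2 - N) = 0 := fun k => by
    induction k with
    | zero => exact ⟨hN _ (by push_cast; omega), hN _ (by push_cast; omega)⟩
    | succ k ih =>
      have := hc ((k + 1 : ℕ) - 1 - N)
      rw [show ((k + 1 : ℕ) : ℤ) - 1 - N - 2 = k - 2 - N by push_cast; ring,
        show ((k + 1 : ℕ) : ℤ) - 1 - N - 1 = k - 1 - N by push_cast; ring, ih.1, ih.2] at this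
      simp only [map_zero, mul_zero, zero_add] at this
      refine ⟨?_, ?_⟩
      · linear_combination ofFun invVFun * this - X.1 ((k + 1 : ℕ) - 1 - N) * v_mul_inv
      · rw [show ((k + 1 : ℕ) : ℤ) - 2 - N = k - 1 - N by push_cast; ring]
        exact ih.1
  refine Subtype.ext (funext fun n => ?_)
  rcases lt_or_ge n (-N : ℤ) with hn | hn
  · exact hN n (by push_cast; omega)
  · have := (hk (n + 1 + N).toNat).1
    rwa [show ((n + 1 + N).toNat : ℤ) - 1 - N = n by omega] at this

theorem bBInv_mul_bB : bBInv * bB 1 = 1 := by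
  refine sub_eq_zero.mp (eq_zero_of_bB_mul ?_)
  rw [mul_sub, ← mul_assoc, bB_mul_bBInv, one_mul, mul_one, sub_self]

theorem bAInv_mul_bA : bAInv * bA (-1) = 1 := by
  refine sub_eq_zero.mp (eq_zero_of_bA_mul ?_)
  rw [mul_sub, ← mul_assoc, bA_mul_bAInv, one_mul, mul_one, sub_self]

/-- `L` as an operator of order bounded above. -/
def bL : BOp 1 := bBInv * bA 1

/-- `L̃` as an operator of order bounded above. -/
def bLt : BOp 1 := bA 1 * bBInv

/-- `M` as an operator of order bounded below. -/
def bM : BOp (-1) := bAInv * bB (-1)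

/-- `M̃` as an operator of order bounded below. -/
def bMt : BOp (-1) := bB (-1) * bAInv

theorem bB_mul_bL : bB 1 * bL = bA 1 := by
  rw [bL, ← mul_assoc, bB_mul_bBInv, one_mul]

theorem bLt_mul_bB : bLt * bB 1 = bA 1 := by
  rw [bLt, mul_assoc, bBInv_mul_bB, mul_one]

theorem bA_mul_bM : bA (-1) * bM = bB (-1) := by
  rw [bM, ← mul_assoc, bA_mul_bAInv, one_mul]

/-! ### The square roots of `L` and `L̃` -/

theorem shift_add_self_eq_zero {f : Fld} (h : shift 1 f + f = 0) : f = 0 := by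
  have hc : shiftAddOneInv * (shift 1 + 1) = 1 := by
    refine Eq.trans ?_ shift_add_one_mul_inv
    simp only [shift, shiftAddOneInv, ← symb_one, ← symb_add, ← symb_mul, mul_comm]
  have := congrArg (fun T : Module.End ℝ Fld => T f) hc
  simpa [h] using this.symm

/-- With D = S - T one has SD + DT = 0. If n is the top order of D, the coefficient of order n + 1
is (Λ + 1)D_n, and Λ + 1 is injective. -/
theorem sqrt_unique {S T : BOp 1} (hS1 : S.1 1 = 1) (hS : ∀ n, 1 < n → S.1 n = 0)
    (hT1 : T.1 1 = 1) (hT : ∀ n, 1 < n → T.1 n = 0) (h : S * S = T * T) : S = T := by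
  have hD : S * (S - T) + (S - T) * T = 0 := by
    rw [mul_sub, sub_mul, h]
    abel
  have hc : ∀ n, (S.1 * (S - T).1) n + ((S - T).1 * T.1) n = 0 := fun n =>
    congrFun (congrArg Subtype.val hD) n
  have hz : ∀ n, 1 < n → (S - T).1 n = 0 := fun n hn => by
    rw [BOp.coe_sub, Op.sub_apply, hS n hn, hT n hn, sub_self]
  have hk : ∀ (k : ℕ) (n : ℤ), 1 - k < n → (S - T).1 n = 0 := fun k => by
    induction k with
    | zero => exact fun n hn => hz n (by simpa using hn)
    | succ k ih =>
      intro n hn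
      rcases lt_or_ge (1 - k : ℤ) n with hn' | hn'
      · exact ih n hn'
      have h1 := hc (n + 1)
      rw [Op.mul_apply_sum _ _ _ {1} fun i hi => ?_, Op.mul_apply_sum _ _ _ {n} fun i hi => ?_] at h1
      · simp only [Finset.sum_singleton, hS1, add_sub_cancel_right, add_sub_cancel_left, hT1,
          shift_one, one_mul, mul_one] at h1
        exact shift_add_self_eq_zero h1
      · rw [Finset.mem_singleton] at hi
        rcases lt_or_gt_of_ne hi with hi | hi
        · exact Or.inr (hT _ (by omega))
        · exact Or.inl (ih _ (by push_cast at hn; omega))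
      · rw [Finset.mem_singleton] at hi
        rcases lt_or_gt_of_ne hi with hi | hi
        · exact Or.inr (ih _ (by push_cast at hn; omega))
        · exact Or.inl (hS _ (by omega))
  refine sub_eq_zero.mp (Subtype.ext (funext fun n => ?_))
  exact hk (2 - n).toNat n (by omega)

theorem Op.sqrt_apply_one (X : Op) : X.sqrt 1 = 1 := by
  simp [Op.sqrt]

theorem Op.sqrt_apply_of_one_lt (X : Op) (n : ℤ) (hn : 1 < n) : X.sqrt n = 0 := by
  rw [Op.sqrt, if_neg (by omega), if_neg (by omega)]

/-- The square root of an operator of order two, as an operator of order bounded above. -/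
def bSqrt (X : Op) : BOp 1 := ⟨X.sqrt, 1, fun n hn => X.sqrt_apply_of_one_lt n (by
  push_cast at hn; omega)⟩

theorem bSqrt_opL_mul_self : bSqrt opL * bSqrt opL = bL := Subtype.ext sqrt_opL_mul_self

theorem bSqrt_opLt_mul_self : bSqrt opLt * bSqrt opLt = bLt := Subtype.ext sqrt_opLt_mul_self

/-- The conjugate squares to L̃. Since B and its inverse are 1 plus negative orders, it has leading
term Λ, and uniqueness applies. -/
theorem bSqrt_opLt : bSqrt opLt = bB 1 * bSqrt opL * bBInv := by
  have hB : ∀ n, 1 ≤ n → (bB 1 * bSqrt opL).1 n = opL.sqrt n := fun n hn => by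
    change (opB * opL.sqrt) n = _
    rw [opB_mul_apply, Op.sqrt_apply_of_one_lt _ (n + 1) (by omega)]
    simp
  have hI : ∀ n, 1 ≤ n → (bB 1 * bSqrt opL * bBInv).1 n = opL.sqrt n := fun n hn => by
    rw [BOp.coe_mul, Op.mul_apply_sum _ _ _ {n} fun i hi => ?_]
    · rw [Finset.sum_singleton, hB n hn, sub_self]
      change _ * shift n (opBInv 0) = _
      simp [opBInv, opBInvCoeff, shift_one]
    · rw [Finset.mem_singleton] at hi
      rcases lt_or_gt_of_ne hi with hi | hi
      · right
        change opBInv (n - i) = 0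
        rw [opBInv, if_neg (by omega)]
      · left
        rw [hB _ (by omega), Op.sqrt_apply_of_one_lt _ _ (by omega)]
  refine sqrt_unique (Op.sqrt_apply_one opLt) (Op.sqrt_apply_of_one_lt opLt) ?_ (fun n hn => ?_) ?_
  · rw [hI 1 le_rfl, Op.sqrt_apply_one]
  · rw [hI n hn.le, Op.sqrt_apply_of_one_lt _ n hn]
  · have h : bB 1 * bSqrt opL * bBInv * (bB 1 * bSqrt opL * bBInv) =
        bB 1 * (bSqrt opL * (bBInv * bB 1) * bSqrt opL) * bBInv := by noncomm_ring
    rw [h, bBInv_mul_bB, mul_one, bSqrt_opL_mul_self, bB_mul_bL, bSqrt_opLt_mul_self, bLt]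

/-! ### Variations -/

theorem der_bA_apply (σ : ℤˣ) (ξ : Fin 3 → Fld) (n : ℤ) :
    (BOp.der ξ (bA σ)).1 n = (if n = 1 then ξ 0 else 0) + (if n = 0 then ξ 1 else 0) := by
  rw [BOp.der_apply]
  change evol ξ (opA n) = _
  rw [opA_apply, evol_add, evol_add]
  split_ifs <;> simp [evol_one, evol_zero, evol_u, evol_v]

theorem der_bB_apply (σ : ℤˣ) (ξ : Fin 3 → Fld) (n : ℤ) :
    (BOp.der ξ (bB σ)).1 n = -(if n = -1 then ξ 2 else 0) := by
  rw [BOp.der_apply]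
  change evol ξ (opB n) = _
  rw [opB_apply, evol_sub]
  split_ifs <;> simp [evol_one, evol_zero, evol_w]

/-- Shifting under the integral frees ξ from all shifts, so the variational derivatives in u and v
can be read off. -/
theorem tr_mul_der_bA {σ : ℤˣ} (ξ : Fin 3 → Fld) (Q : BOp σ) :
    BOp.tr (Q * BOp.der ξ (bA σ)) = intg (ξ 0 * shift 1 (Q.1 (-1)) + ξ 1 * Q.1 0) := by
  rw [BOp.tr_apply, BOp.coe_mul, Op.mul_apply_sum _ _ _ {-1, 0} fun i hi => Or.inr (by
    simp only [Finset.mem_insert, Finset.mem_singleton, not_or] at hi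
    rw [der_bA_apply, if_neg (by omega), if_neg (by omega), add_zero])]
  rw [Finset.sum_insert (by simp), Finset.sum_singleton, map_add, map_add, ← intg_shift 1,
    der_bA_apply, der_bA_apply]
  norm_num [shift_mul, shift_shift, shift_zero_apply, mul_comm]

theorem tr_mul_der_bB {σ : ℤˣ} (ξ : Fin 3 → Fld) (R : BOp σ) :
    BOp.tr (R * BOp.der ξ (bB σ)) = -intg (ξ 2 * shift (-1) (R.1 1)) := by
  rw [BOp.tr_apply, BOp.coe_mul, Op.mul_apply_sum _ _ _ {1} fun i hi => Or.inr (by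
    rw [Finset.mem_singleton] at hi
    rw [der_bB_apply, if_neg (by omega), neg_zero])]
  rw [Finset.sum_singleton, ← intg_shift (-1), der_bB_apply]
  norm_num [shift_mul, shift_shift, shift_zero_apply, mul_comm]

/-- If the first variation of `∫ f dx` is `c ∫ Res (Q δA - R δB) dx` with `B R = A Q` and
`R B = Q A`, then the Lax equations of `(B Q)_+` and `(Q B)_+` are Hamiltonian with density `f`. -/
theorem laxPair_iff_of_variation {σ : ℤˣ} (c : ℝ) (Q R : BOp σ) (hl : bB σ * R = bA σ * Q)
    (hr : R * bB σ = Q * bA σ) (f : Fld)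
    (hf : ∀ ξ, intg (evol ξ f) =
      c • BOp.tr (Q * BOp.der ξ (bA σ) - R * BOp.der ξ (bB σ))) (X : Fin 3 → Fld) :
    LaxPair c (opB * Q.1).pos (Q.1 * opB).pos X ↔
      (fun α => eps * X α) = P1.app (varDeriv f) := by
  have hv : varDeriv f = c • ![shift 1 (Q.1 (-1)), Q.1 0, shift (-1) (R.1 1)] := by
    refine varDeriv_eq_of_intg_evol fun ξ => ?_
    rw [hf, map_sub, tr_mul_der_bA, tr_mul_der_bB, sub_neg_eq_add, ← map_add, ← map_smul]
    simp [Fin.sum_univ_three]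
  have hA : opB * Q.1 * opA = opA * (Q.1 * opB) := by
    have h : bB σ * Q * bA σ = bA σ * (Q * bB σ) := by
      rw [mul_assoc, ← hr, ← mul_assoc, hl, mul_assoc]
    exact congrArg Subtype.val h
  rw [hv]
  refine laxPair_pos_iff c Q.1 _ X hA ?_
  have h1 : (opB * R.1) 0 = (opA * Q.1) 0 := congrFun (congrArg Subtype.val hl) 0
  have h2 : (R.1 * opB) 0 = (Q.1 * opA) 0 := congrFun (congrArg Subtype.val hr) 0
  -- In (BR)_0 - (RB)_0 the coefficient R_0 cancels, leaving (Λ - 1)(w Λ^{-1}R_1).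
  rw [← h1, ← h2, opB_mul_apply, mul_opB_apply]
  norm_num [shift_mul, shift_shift, shift_zero_apply]
  ring

/-- Differentiating BL = A avoids the derivative of the inverse of B. -/
theorem der_bL (ξ : Fin 3 → Fld) :
    BOp.der ξ bL = bBInv * (BOp.der ξ (bA 1) - BOp.der ξ (bB 1) * bL) := by
  rw [← bB_mul_bL, BOp.der_mul, add_sub_cancel_left, ← mul_assoc, bBInv_mul_bB, one_mul]

theorem der_bM (ξ : Fin 3 → Fld) :
    BOp.der ξ bM = bAInv * (BOp.der ξ (bB (-1)) - BOp.der ξ (bA (-1)) * bM) := by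
  rw [← bA_mul_bM, BOp.der_mul, add_sub_cancel_left, ← mul_assoc, bAInv_mul_bA, one_mul]

/-- The flow of an operator `N` that commutes with `L`. -/
theorem laxPair_iff_of_commute_bL (c : ℝ) (N Nt : BOp 1) (hN : Commute N bL)
    (hNt : SemiconjBy (bB 1) N Nt) (f : Fld)
    (hf : ∀ ξ, intg (evol ξ f) = c • BOp.tr (N * BOp.der ξ bL)) (X : Fin 3 → Fld) :
    LaxPair c Nt.1.pos N.1.pos X ↔ (fun α => eps * X α) = P1.app (varDeriv f) := by
  have h1 : Nt.1 = opB * (N * bBInv).1 := by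
    have : Nt = bB 1 * (N * bBInv) := by
      rw [← mul_assoc, hNt.eq, mul_assoc, bB_mul_bBInv, mul_one]
    exact congrArg Subtype.val this
  have h2 : N.1 = (N * bBInv).1 * opB := by
    have : N = N * bBInv * bB 1 := by rw [mul_assoc, bBInv_mul_bB, mul_one]
    exact congrArg Subtype.val this
  rw [h1]
  conv_lhs => rw [h2]
  -- R is B^{-1}AQ for Q = N B^{-1}; the relation RB = QA is LN = NL.
  refine laxPair_iff_of_variation c (N * bBInv) (bL * N * bBInv) ?_ ?_ f (fun ξ => ?_) X
  · rw [← mul_assoc, ← mul_assoc, bB_mul_bL, mul_assoc]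
  · rw [mul_assoc, bBInv_mul_bB, mul_one, ← hN.eq, mul_assoc, ← bL]
  · rw [hf, der_bL, map_sub, mul_assoc bL, mul_assoc bL, BOp.tr_mul_comm bL, ← map_sub]
    refine congrArg (fun Z => c • BOp.tr Z) ?_
    noncomm_ring

/-! ### Division by ε: existence and uniqueness of the flows -/

theorem existsUnique_eps_mul_eq_P1_app (Y : Fin 3 → Fld) :
    ∃! X : Fin 3 → Fld, (fun α => eps * X α) = P1.app Y := by
  -- Modulo ε every shift is the identity, and the entries of 𝒫₁ then cancel.
  have h0 : ∀ α, PowerSeries.coeff 0 (P1.app Y α) = 0 := by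
    have hw : ∀ f : Fld, PowerSeries.coeff 0 (w * f) =
        PowerSeries.coeff 0 w * PowerSeries.coeff 0 f := fun f => by simp
    have hu : ∀ f : Fld, PowerSeries.coeff 0 (u * f) =
        PowerSeries.coeff 0 u * PowerSeries.coeff 0 f := fun f => by simp
    intro α
    fin_cases α
    · change PowerSeries.coeff 0 (P1.app Y 0) = 0
      rw [P1_app_zero]
      simp only [map_add, map_sub, coeff_zero_shift, hw]
      ring
    · change PowerSeries.coeff 0 (P1.app Y 1) = 0
      rw [P1_app_one]
      simp only [map_add, map_sub, coeff_zero_shift, hw, hu]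
      ring
    · change PowerSeries.coeff 0 (P1.app Y 2) = 0
      rw [P1_app_two]
      simp only [map_sub, coeff_zero_shift, hw]
      ring
  refine ⟨fun α => PowerSeries.mk fun n => PowerSeries.coeff (n + 1) (P1.app Y α), ?_, ?_⟩
  · funext α
    conv_rhs => rw [fld_eq_eps_mul_add (P1.app Y α), h0, map_zero, add_zero]
  · intro X hX
    funext α
    refine eps_mul_left_cancel ?_
    rw [congrFun hX α]
    conv_lhs => rw [fld_eq_eps_mul_add (P1.app Y α), h0, map_zero, add_zero]

/-! ### The three families of flows -/

theorem isFlow_t3_iff (k : ℕ) (X : Fin 3 → Fld) :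
    IsFlow (.t3 k) X ↔ (fun α => eps * X α) = P1.app (varDeriv (ham (.t3 k))) := by
  have h := laxPair_iff_of_commute_bL (1 / (Nat.factorial (k + 1) : ℝ)) (bL ^ (k + 1))
    (bLt ^ (k + 1)) ((Commute.refl bL).pow_left _)
    (SemiconjBy.pow_right (bB_mul_bL.trans bLt_mul_bB.symm) _) (ham (.t3 k)) (fun ξ => ?_) X
  · rw [BOp.coe_pow, BOp.coe_pow] at h
    exact h
  · change intg (evol ξ ((1 / (Nat.factorial (k + 1 + 1) : ℝ)) • (bL.1 ^ (k + 1 + 1)).res)) = _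
    rw [evol_smul, map_smul, BOp.intg_evol_res_pow, ← Nat.cast_smul_eq_nsmul ℝ, smul_smul]
    congr 1
    rw [Nat.factorial_succ (k + 1)]
    push_cast
    field_simp

theorem isFlow_t2_iff (k : ℕ) (X : Fin 3 → Fld) :
    IsFlow (.t2 k) X ↔ (fun α => eps * X α) = P1.app (varDeriv (ham (.t2 k))) := by
  have hB : SemiconjBy (bB 1) (bSqrt opL) (bSqrt opLt) := by
    rw [SemiconjBy, bSqrt_opLt, mul_assoc, mul_assoc, bBInv_mul_bB, mul_one]
  have hc : Commute (bSqrt opL) bL := by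
    rw [← bSqrt_opL_mul_self]
    exact (Commute.refl _).mul_right (Commute.refl _)
  have h := laxPair_iff_of_commute_bL
    ((2 : ℝ) ^ ((k : ℝ) + 1 / 2) / (Nat.doubleFactorial (2 * k + 1) : ℝ))
    (bSqrt opL ^ (2 * k + 1)) (bSqrt opLt ^ (2 * k + 1)) (hc.pow_left _)
    (hB.pow_right _) (ham (.t2 k)) (fun ξ => ?_) X
  · rw [BOp.coe_pow, BOp.coe_pow] at h
    exact h
  -- With S² = L, δL = S δS + δS S gives the factor 2 under the trace. It matches the ratio 2/(2k+3)
  -- of consecutive normalizing constants.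
  · have hL : BOp.tr (bSqrt opL ^ (2 * k + 1) * BOp.der ξ bL) =
        (2 : ℝ) • BOp.tr (bSqrt opL ^ (2 * k + 2) * BOp.der ξ (bSqrt opL)) := by
      rw [← bSqrt_opL_mul_self, BOp.der_mul, mul_add, map_add, ← mul_assoc,
        BOp.tr_mul_comm _ (bSqrt opL), ← mul_assoc, ← mul_assoc, ← pow_succ', ← pow_succ, two_smul]
    change intg (evol ξ (((2 : ℝ) ^ (((k + 1 : ℕ) : ℝ) + 1 / 2) /
      (Nat.doubleFactorial (2 * (k + 1) + 1) : ℝ)) •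
      ((bSqrt opL).1 ^ (2 * k + 2 + 1)).res)) = _
    rw [evol_smul, map_smul, BOp.intg_evol_res_pow, hL, ← Nat.cast_smul_eq_nsmul ℝ, smul_smul,
      smul_smul]
    congr 1
    have h2 : (2 : ℝ) ^ (((k + 1 : ℕ) : ℝ) + 1 / 2) = 2 ^ ((k : ℝ) + 1 / 2) * 2 := by
      rw [← Real.rpow_add_one two_ne_zero]
      congr 1
      push_cast
      ring
    have hd : (Nat.doubleFactorial (2 * (k + 1) + 1) : ℝ) =
        (2 * k + 3) * (Nat.doubleFactorial (2 * k + 1) : ℝ) := by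
      rw [show 2 * (k + 1) + 1 = 2 * k + 1 + 2 by ring, Nat.doubleFactorial_add_two]
      push_cast
      ring
    have hp : (Nat.doubleFactorial (2 * k + 1) : ℝ) ≠ 0 :=
      Nat.cast_ne_zero.mpr (Nat.doubleFactorial_pos _).ne'
    have hk : (2 * (k : ℝ) + 3) ≠ 0 := by positivity
    rw [h2, hd]
    push_cast
    field_simp
    ring

/-! ### The flows generated by powers of M -/

theorem bB_mul_bM_pow_mul_bAInv (k : ℕ) : bB (-1) * (bM ^ k * bAInv) = bMt ^ (k + 1) := by
  have h : SemiconjBy (bB (-1)) bM bMt := by rw [SemiconjBy, bM, bMt, mul_assoc]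
  rw [← mul_assoc, (h.pow_right k).eq, mul_assoc, ← bMt, ← pow_succ]

theorem bM_pow_mul_bAInv_mul_bB (k : ℕ) : bM ^ k * bAInv * bB (-1) = bM ^ (k + 1) := by
  rw [mul_assoc, ← bM, ← pow_succ]

/-- The Lax equations of `M^{k+1}` in terms of `Q = -M^k A⁻¹`. -/
theorem isFlow_t0_iff_laxPair_pos (k : ℕ) (X : Fin 3 → Fld) :
    IsFlow (.t0 k) X ↔ LaxPair ((-1 : ℝ) ^ k * (Nat.factorial k : ℝ))
      (opB * (-(bM ^ k * bAInv)).1).pos ((-(bM ^ k * bAInv)).1 * opB).pos X := by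
  have h1 : opMt ^ (k + 1) = -(opB * (-(bM ^ k * bAInv)).1) := by
    have h : bMt ^ (k + 1) = -(bB (-1) * (-(bM ^ k * bAInv))) := by
      rw [mul_neg, neg_neg, bB_mul_bM_pow_mul_bAInv]
    have := congrArg Subtype.val h
    rw [BOp.coe_pow] at this
    exact this
  have h2 : opM ^ (k + 1) = -((-(bM ^ k * bAInv)).1 * opB) := by
    have h : bM ^ (k + 1) = -(-(bM ^ k * bAInv) * bB (-1)) := by
      rw [neg_mul, neg_neg, bM_pow_mul_bAInv_mul_bB]
    have := congrArg Subtype.val h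
    rw [BOp.coe_pow] at this
    exact this
  rw [IsFlow, h1, h2]
  refine laxPair_neg_iff _ _ X ?_
  have h : bB (-1) * (-(bM ^ k * bAInv)) * bA (-1) = bA (-1) * (-(bM ^ k * bAInv) * bB (-1)) := by
    rw [neg_mul, bM_pow_mul_bAInv_mul_bB, mul_neg, neg_mul, mul_neg, mul_assoc, mul_assoc,
      bAInv_mul_bA, mul_one, pow_succ', ← mul_assoc (bA (-1)), bA_mul_bM]
  exact congrArg Subtype.val h

/-- The function `1 / w`. -/
def invWFun : SmoothFun :=
  mkSmooth (fun p => (p 2)⁻¹)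
    ((contDiff_apply ℝ ℝ 2).contDiffOn.inv fun _ hp => (ne_zero_of_mem hp).2)

theorem w_mul_inv : w * ofFun invWFun = 1 := by
  have h : coordFun 2 * invWFun = 1 :=
    Subtype.ext (funext fun p => mul_inv_cancel₀ (ne_zero_of_mem p.2).2)
  rw [w, ofFun, ofFun, ← map_mul, ← map_mul, h, map_one, map_one]

theorem partialFun_logWVFun (α : Fin 3) :
    partialFun α logWVFun = ![0, -invVFun, invWFun] α := by
  refine Subtype.ext (funext fun p => ?_)
  obtain ⟨h1, h2⟩ := ne_zero_of_mem p.2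
  have hd : ∀ β : Fin 3, HasFDerivAt (fun q : Fin 3 → ℝ => q β)
      (ContinuousLinearMap.proj (R := ℝ) (φ := fun _ : Fin 3 => ℝ) β) p.1 := fun β =>
    (ContinuousLinearMap.proj (R := ℝ) (φ := fun _ : Fin 3 => ℝ) β).hasFDerivAt
  have hlog : (fun q : Fin 3 → ℝ => Real.log (q 2 / q 1)) =ᶠ[nhds p.1]
      fun q => Real.log (q 2) - Real.log (q 1) := by
    filter_upwards [isOpen_dom.mem_nhds p.2] with q hq
    exact Real.log_div (ne_zero_of_mem hq).2 (ne_zero_of_mem hq).1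
  have hf := (((hd 2).log h2).sub ((hd 1).log h1)).congr_of_eventuallyEq hlog
  rw [logWVFun, partialFun_mkSmooth, hf.fderiv]
  fin_cases α
  · change _ = (0 : ℝ)
    simp
  · change _ = -(p.1 1)⁻¹
    simp
  · change _ = (p.1 2)⁻¹
    simp

theorem varDeriv_ofFun (f : SmoothFun) (α : Fin 3) :
    varDeriv (ofFun f) α = ofFun (partialFun α f) := by
  have h : varDeriv (ofFun f) = fun α => ofFun (partialFun α f) := by
    refine varDeriv_eq_of_intg_evol fun X => congrArg intg ?_
    ext1 n
    simp only [ofFun, coeff_evol_C, evD_C, map_sum, PowerSeries.coeff_mul_C]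
  rw [h]

theorem isFlow_t0_iff (k : ℕ) (X : Fin 3 → Fld) :
    IsFlow (.t0 k) X ↔ (fun α => eps * X α) = P1.app (varDeriv (ham (.t0 k))) := by
  rw [isFlow_t0_iff_laxPair_pos]
  rcases k with _ | k
  -- For Q = -A^{-1} the density is not a residue. The triple is (0, -1/v, 1/w), and ρ = 1/w is
  -- admissible because wρ = 1 is shift invariant and AQ = QA.
  · have hv : varDeriv (ham (.t0 0)) = ((-1 : ℝ) ^ 0 * (Nat.factorial 0 : ℝ)) •
        ![shift 1 ((-(bM ^ 0 * bAInv)).1 (-1)), (-(bM ^ 0 * bAInv)).1 0, ofFun invWFun] := by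
      have hQ : ∀ n, (-(bM ^ 0 * bAInv)).1 n = -opAInv n := fun n => by
        rw [pow_zero, one_mul]
        rfl
      funext α
      change varDeriv (ofFun logWVFun) α = _
      rw [varDeriv_ofFun, partialFun_logWVFun, hQ, hQ]
      fin_cases α <;> simp [opAInv, opAInvCoeff, ofFun]
    rw [hv]
    have hl : bA (-1) * (-(bM ^ 0 * bAInv)) = -1 := by
      rw [pow_zero, one_mul, mul_neg, bA_mul_bAInv]
    have hr : -(bM ^ 0 * bAInv) * bA (-1) = -1 := by
      rw [pow_zero, one_mul, neg_mul, bAInv_mul_bA]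
    refine laxPair_pos_iff _ _ _ X ?_ ?_
    · have h : bB (-1) * (-(bM ^ 0 * bAInv)) * bA (-1) =
          bA (-1) * (-(bM ^ 0 * bAInv) * bB (-1)) := by
        rw [mul_assoc, hr, ← mul_assoc, hl]
        noncomm_ring
      exact congrArg Subtype.val h
    · have h1 := congrFun (congrArg Subtype.val hl) 0
      have h2 := congrFun (congrArg Subtype.val hr) 0
      rw [w_mul_inv, shift_one, sub_self, eq_comm, sub_eq_zero]
      exact h1.trans h2.symm
  -- Q is -M^{k+1}A^{-1}. Lowering the power of M by one gives R, because AM = B and MA^{-1}A =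
  -- A^{-1}B.
  · refine laxPair_iff_of_variation _ _ (-(bM ^ k * bAInv)) ?_ ?_ _ (fun ξ => ?_) X
    · rw [mul_neg, mul_neg, pow_succ', mul_assoc, ← mul_assoc (bA (-1)), bA_mul_bM]
    · rw [neg_mul, neg_mul, bM_pow_mul_bAInv_mul_bB, mul_assoc, bAInv_mul_bA, mul_one]
    · have hM : BOp.tr (bM ^ k * BOp.der ξ bM) = BOp.tr (-(bM ^ (k + 1) * bAInv) *
          BOp.der ξ (bA (-1)) - -(bM ^ k * bAInv) * BOp.der ξ (bB (-1))) := by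
        have h1 : bM ^ k * BOp.der ξ bM = bM ^ k * bAInv * BOp.der ξ (bB (-1)) -
            bM ^ k * bAInv * BOp.der ξ (bA (-1)) * bM := by
          rw [der_bM]
          noncomm_ring
        have h2 : bM * (bM ^ k * bAInv * BOp.der ξ (bA (-1))) =
            bM ^ (k + 1) * bAInv * BOp.der ξ (bA (-1)) := by
          rw [pow_succ']
          noncomm_ring
        rw [h1, map_sub, BOp.tr_mul_comm _ bM, h2, ← map_sub]
        refine congrArg BOp.tr ?_
        noncomm_ring
      change intg (evol ξ (((-1 : ℝ) ^ (k + 1) * (Nat.factorial k : ℝ)) •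
        (bM.1 ^ (k + 1)).res)) = _
      rw [evol_smul, map_smul, BOp.intg_evol_res_pow, hM, ← Nat.cast_smul_eq_nsmul ℝ, smul_smul,
        Nat.factorial_succ]
      congr 1
      push_cast
      ring

theorem isFlow_iff (t : Time) (X : Fin 3 → Fld) :
    IsFlow t X ↔ (fun α => eps * X α) = P1.app (varDeriv (ham t)) := by
  cases t with
  | t2 k => exact isFlow_t2_iff k X
  | t3 k => exact isFlow_t3_iff k X
  | t0 k => exact isFlow_t0_iff k X

end

end RR2T

theorem mainTheorem1 :
    RR2T.IsHamiltonian RR2T.P1 ∧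
    ∀ t : RR2T.Time,
      (∃! X : Fin 3 → RR2T.Fld, RR2T.IsFlow t X) ∧
      ∀ X : Fin 3 → RR2T.Fld, RR2T.IsFlow t X ↔
        (fun α => RR2T.eps * X α) = RR2T.P1.app (RR2T.varDeriv (RR2T.ham t)) := by
  refine ⟨RR2T.isHamiltonian_P1, fun t => ⟨?_, RR2T.isFlow_iff t⟩⟩
  simp only [RR2T.isFlow_iff]
  exact RR2T.existsUnique_eps_mul_eq_P1_app _
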